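/- **Setting.** Let $J^0=\mathbb R^2$ have coordinates $(x,y)$ and $J^1=J^1(\mathbb R,\mathbb R)=\mathbb R^3$ coordinates $(x,y,p)$, $p=y'$. Let $U\subseteq J^1$ be open and $f:U\to\mathbb R$ real analytic; put $\mathfrak D=\partial_x+p\,\partial_y+f\,\partial_p$ and assume that the equation $y''=f(x,y,y')$ satisfies $$f_y+\tfrac29 f_p^2-\tfrac13\mathfrak D(f_p)=0\quad\text{on }U. \tag{$*$}$$ Let $ASL(2,\mathbb R)=\{\begin{pmatrix}1&0\\ \xi&A\end{pmatrix}:\xi\in\mathbb R^2,\ A\in SL(2,\mathbb R)\}$, with Lie algebra $\mathfrak{asl}(2,\mathbb R)$ (the $3\times3$ matrices with zero first row and zero trace), let $$H=\left\{h(v_1,v_3)=\begin{pmatrix}1&0&0\\0&v_1&-v_3\\0&0&1/v_1\end{pmatrix}: v_1\ne0,\ v_3\in\mathbb R\right\}\subset ASL(2,\mathbb R),$$ and let $\mathfrak h$ be its Lie algebra. Let $B_U=U\times H$, with coordinates $(x,y,p,u_1,u_3)$ (the point $((x,y,p),h(u_1,u_3))$), let $H$ act by $(q,S)\cdot T=(q,ST)$,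 and on $B_U$ put $$\begin{aligned}\theta^1&=u_1(dy-p\,dx),\qquad \theta^2=u_1^2\big(dp-f\,dx-\tfrac13f_p(dy-p\,dx)\big),\qquad \theta^3=u_3(dy-p\,dx)+\tfrac1{u_1}dx,\\ \Omega^1&=\tfrac{du_1}{u_1}+\tfrac{u_3}{u_1}\theta^2+\tfrac13u_1f_p\,\theta^3+\tfrac1{6u_1}(f_{pp}-2u_1u_3f_p)\,\theta^1,\\ \Omega^2&=\tfrac{u_3}{u_1^2}du_1+\tfrac{du_3}{u_1}+\big(\tfrac{u_3}{u_1}\big)^2\theta^2+\tfrac13u_3f_p\,\theta^3-\tfrac1{6u_1}(f_{pp}-2u_1u_3f_p)\,\theta^3\\&\quad+\Big(-\tfrac23\tfrac{u_3^2}{u_1}f_p-\tfrac1{6u_1^3}f_{ppp}+\tfrac12\tfrac{u_3}{u_1^2}f_{pp}\Big)\theta^1,\end{aligned}\qquad \omega_f=\begin{pmatrix}0&0&0\\ \theta^3&\Omega^1&-\Omega^2\\ \theta^1&\theta^2&-\Omega^1\end{pmatrix}.$$ **Theorem.** 1. (Cartan geometry.) $B_U\to U$ is a (5-dimensional) principal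 right $H$-bundle, and $\omega_f$ is a Cartan connection on it modeled on $(\mathfrak{asl}(2,\mathbb R),\mathfrak h)$: it is smooth, each $(\omega_f)_b:T_bB_U\to\mathfrak{asl}(2,\mathbb R)$ is a linear isomorphism, $R_T^*\omega_f=\mathrm{Ad}_{T^{-1}}\omega_f$ for $T\in H$, and $\omega_f(\rho(X))=X$ for $X\in\mathfrak h$, where $\rho(X)_b=\frac{d}{dt}\big|_{0}\,b\cdot\exp(tX)$. 2. (Normality and uniqueness.) For a matrix $\omega$ of 1-forms on $B_U$ let $\eta=s^*\omega=\begin{pmatrix}0&0&0\\ \eta^1&\eta^1_1&\eta^1_2\\ \eta^2&\eta^2_1&\eta^2_2\end{pmatrix}$ be its pull-back by the section $s(q)=(q,e)$ ($u_1=1,u_3=0$), and let $\Theta^1,\Theta^2,\Theta^i_j$ be the corresponding entries of $d\eta+\eta\wedge\eta$. Call $\omega$ normal if $\eta^1=dx$, $\eta^2=dy-p\,dx$, $\eta^2_1=\Pi:=dp-f\,dx+\mu(dy-p\,dx)$ for some function $\mu$ on $U$, $\Theta^1=\Theta^2=0$, and the coefficients of $\eta^1\wedge\Pi$ and $\eta^2\wedge\Pi$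 in $\Theta^1_1$ and in $\Theta^2_1$ vanish. Then $\omega_f$ is normal, and it is the only normal Cartan connection on $B_U$ modeled on $(\mathfrak{asl}(2,\mathbb R),\mathfrak h)$. 3. (Curvature.) With $$\begin{aligned}I_1&=-\tfrac13f_{py}-\tfrac1{18}f_pf_{pp}+\tfrac16\mathfrak D(f_{pp}),\qquad I_2=-\tfrac1{6u_1^5}f_{pppp},\\ I_3&=\tfrac1{u_1^2}\big(\tfrac16f_{ppy}-\tfrac16\mathfrak D(f_{ppp})-\tfrac19f_pf_{ppp}+\tfrac1{18}f_{pp}^2\big)+2\tfrac{u_3}{u_1}I_1,\end{aligned}$$ one has $$d\omega_f+\omega_f\wedge\omega_f=\begin{pmatrix}0&0&0\\0&I_1\,\theta^3\wedge\theta^1&-I_2\,\theta^2\wedge\theta^1-I_3\,\theta^3\wedge\theta^1\\0&0&-I_1\,\theta^3\wedge\theta^1\end{pmatrix}.$$ The curvature contains all the non-constant coefficients of the structure equations of the coframe, which read $$\begin{gathered}d\theta^1=\Omega^1\wedge\theta^1+\theta^3\wedge\theta^2,\qquad d\theta^2=2\,\Omega^1\wedge\theta^2,\qquad d\theta^3=\Omega^2\wedge\theta^1-\Omega^1\wedge\theta^3,\\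 d\Omega^1=\Omega^2\wedge\theta^2+I_1\theta^3\wedge\theta^1,\qquad d\Omega^2=2\,\Omega^2\wedge\Omega^1+I_2\theta^2\wedge\theta^1+I_3\theta^3\wedge\theta^1,\end{gathered}$$ and $I_1,I_2,I_3$ are invariants: $\bar I_k\circ F=I_k$ for every isomorphism $F$ as in 4. 4. (Equivalence.) Let $\bar y''=\bar f(\bar x,\bar y,\bar y')$, with $\bar f$ real analytic on the open set $\bar U\subseteq J^1$, also satisfy ($*$) (for $\bar f$). For open $V\subseteq U$ and $\bar V\subseteq\bar U$, an *area-preserving equivalence* $V\to\bar V$ is a real analytic map $\Phi=(\chi,\phi)$ on the image of $V$ in $J^0$ with $\chi_x\phi_y-\chi_y\phi_x\equiv1$, such that $\chi_x+p\chi_y\neq0$ on $V$, the first prolongation $\Phi^{(1)}(x,y,p)=\big(\chi,\phi,\frac{\phi_x+p\phi_y}{\chi_x+p\chi_y}\big)$ maps $V$ bijectively onto $\bar V$, and $\Phi$ maps the graph of every solution of $y''=f$ on an open interval with 1-jets in $V$ onto the graph of a solution of $\bar y''=\bar f$ on an open interval with 1-jets in $\bar V$. An *isomorphism* $B_V\to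 B_{\bar V}$ is a real analytic bijection $F$ with $F(b\cdot T)=F(b)\cdot T$ for all $T\in H$ and $F^*\omega_{\bar f}=\omega_f$. Then: * (local) for $q\in U$ and $\bar q\in\bar U$ there are open neighbourhoods $V\subseteq U$ of $q$, $\bar V\subseteq\bar U$ of $\bar q$ and an area-preserving equivalence $V\to\bar V$ whose prolongation maps $q$ to $\bar q$ if and only if there are open neighbourhoods $V\subseteq U$ of $q$, $\bar V\subseteq\bar U$ of $\bar q$ and an isomorphism $B_V\to B_{\bar V}$ that maps the fibre over $q$ into the fibre over $\bar q$; * (global) if every set $\{p:(x,y,p)\in U\}$ is connected or empty (for example $U=J^1$), there is an area-preserving equivalence $U\to\bar U$ if and only if there is an isomorphism $B_U\to B_{\bar U}$. -/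

import Mathlib

open Set Matrix Topology

noncomputable section

namespace AreaPreservingODE

/-! ### Groups and Lie algebras -/

/-- Real `3 × 3` matrices (indices `0, 1, 2`). -/
abbrev Mat3 : Type := Matrix (Fin 3) (Fin 3) ℝ

-- the commutator bracket on matrices
attribute [local instance] LieRing.ofAssociativeRing

/-- `ASL(2, ℝ)`: the matrices `(1 0; x A)` with `x ∈ ℝ²` and `A ∈ SL(2, ℝ)`. -/
def ASL : Subgroup (Matrix.SpecialLinearGroup (Fin 3) ℝ) where
  carrier := {T | T 0 0 = 1 ∧ T 0 1 = 0 ∧ T 0 2 = 0}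
  one_mem' := by simp
  mul_mem' := by
    rintro S T ⟨h1, h2, h3⟩ ⟨k1, k2, k3⟩
    simp [Matrix.mul_apply, Fin.sum_univ_three, h1, h2, h3, k1, k2, k3]
  inv_mem' := by
    rintro S ⟨h1, h2, h3⟩
    have hd := S.det_coe
    rw [Matrix.det_fin_three] at hd
    simp [h1, h2, h3] at hd
    have e : ∀ i j, (S⁻¹ : Matrix.SpecialLinearGroup (Fin 3) ℝ) i j = adjugate (S : Mat3) i j :=
      fun i j => congrFun (congrFun (Matrix.SpecialLinearGroup.coe_inv S) i) j
    refine ⟨(e _ _).trans ?_, (e _ _).trans ?_, (e _ _).trans ?_⟩ <;>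
      simp [adjugate_fin_three, h2, h3, hd]

/-- The subgroup `H ⊆ ASL(2, ℝ)` of the matrices `(1 0 0; 0 v₁ -v₃; 0 0 1/v₁)`
(see `mem_H_iff`). -/
def H : Subgroup (Matrix.SpecialLinearGroup (Fin 3) ℝ) where
  carrier := {T | T ∈ ASL ∧ T 1 0 = 0 ∧ T 2 0 = 0 ∧ T 2 1 = 0}
  one_mem' := ⟨ASL.one_mem, by simp⟩
  mul_mem' := by
    rintro S T ⟨hS, h1, h2, h3⟩ ⟨hT, k1, k2, k3⟩
    refine ⟨ASL.mul_mem hS hT, ?_⟩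
    simp [Matrix.mul_apply, Fin.sum_univ_three, h1, h2, h3, k1, k2, k3]
  inv_mem' := by
    rintro S ⟨hS, h1, h2, h3⟩
    refine ⟨ASL.inv_mem hS, ?_⟩
    have e : ∀ i j, (S⁻¹ : Matrix.SpecialLinearGroup (Fin 3) ℝ) i j = adjugate (S : Mat3) i j :=
      fun i j => congrFun (congrFun (Matrix.SpecialLinearGroup.coe_inv S) i) j
    refine ⟨(e _ _).trans ?_, (e _ _).trans ?_, (e _ _).trans ?_⟩ <;>
      simp [adjugate_fin_three, h1, h2, h3]

/-- The matrix with coordinates `(v₁, v₃)` in `H` (for `v₁ ≠ 0`). -/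
def hMat (v₁ v₃ : ℝ) : Mat3 := !![1, 0, 0; 0, v₁, -v₃; 0, 0, 1 / v₁]

theorem H_le_ASL : H ≤ ASL := fun _ h => h.1

theorem isClosed_H : IsClosed (H : Set (Matrix.SpecialLinearGroup (Fin 3) ℝ)) := by
  have hc : ∀ i j, Continuous fun T : Matrix.SpecialLinearGroup (Fin 3) ℝ => T i j :=
    fun i j => continuous_subtype_val.matrix_elem i j
  have e : (H : Set (Matrix.SpecialLinearGroup (Fin 3) ℝ)) =
      {T | (T 0 0 = 1 ∧ T 0 1 = 0 ∧ T 0 2 = 0) ∧ T 1 0 = 0 ∧ T 2 0 = 0 ∧ T 2 1 = 0} := rfl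
  rw [e]
  have h := fun i j (r : ℝ) => isClosed_eq (hc i j) (continuous_const (y := r))
  exact ((h _ _ _).inter ((h _ _ _).inter (h _ _ _))).inter
    ((h _ _ _).inter ((h _ _ _).inter (h _ _ _)))

theorem mem_H_iff (T : Matrix.SpecialLinearGroup (Fin 3) ℝ) :
    T ∈ H ↔ ∃ v₁ v₃ : ℝ, v₁ ≠ 0 ∧ (T : Mat3) = hMat v₁ v₃ := by
  constructor
  · rintro ⟨⟨h1, h2, h3⟩, h4, h5, h6⟩
    have hd := T.det_coe
    rw [Matrix.det_fin_three] at hd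
    simp [h1, h2, h3, h4, h5, h6] at hd
    have hne : T 1 1 ≠ 0 := by
      intro h; simp [h] at hd
    refine ⟨T 1 1, -T 1 2, hne, ?_⟩
    ext i j
    fin_cases i <;> fin_cases j <;> simp [hMat, h1, h2, h3, h4, h5, h6]
    field_simp
    linarith
  · rintro ⟨v₁, v₃, _, h⟩
    have e : ∀ i j, T i j = hMat v₁ v₃ i j := fun i j => by rw [← h]
    refine ⟨⟨?_, ?_, ?_⟩, ?_, ?_, ?_⟩ <;> rw [e] <;> simp [hMat]

/-- `𝔞𝔰𝔩(2, ℝ)`: the matrices with zero first row and zero trace. -/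
def asl : LieSubalgebra ℝ Mat3 where
  carrier := {X | X 0 0 = 0 ∧ X 0 1 = 0 ∧ X 0 2 = 0 ∧ X 1 1 + X 2 2 = 0}
  zero_mem' := by simp
  add_mem' := by
    rintro X Y ⟨h1, h2, h3, h4⟩ ⟨k1, k2, k3, k4⟩
    refine ⟨by simp [h1, k1], by simp [h2, k2], by simp [h3, k3], ?_⟩
    simp only [Matrix.add_apply]; linarith
  smul_mem' := by
    rintro c X ⟨h1, h2, h3, h4⟩
    refine ⟨by simp [h1], by simp [h2], by simp [h3], ?_⟩
    simp only [Matrix.smul_apply, smul_eq_mul, ← mul_add, h4, mul_zero]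
  lie_mem' := by
    rintro X Y ⟨h1, h2, h3, h4⟩ ⟨k1, k2, k3, k4⟩
    simp [Ring.lie_def, Matrix.mul_apply, Fin.sum_univ_three, h1, h2, h3, k1, k2, k3]
    ring

/-- `𝔥`, the Lie algebra of `H`: the matrices `(0 0 0; 0 a b; 0 0 -a)`. -/
def hLie : LieSubalgebra ℝ Mat3 where
  carrier := {X | X ∈ asl ∧ X 1 0 = 0 ∧ X 2 0 = 0 ∧ X 2 1 = 0}
  zero_mem' := ⟨asl.zero_mem, by simp⟩
  add_mem' := by
    rintro X Y ⟨hX, h1, h2, h3⟩ ⟨hY, k1, k2, k3⟩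
    exact ⟨asl.add_mem hX hY, by simp [h1, k1], by simp [h2, k2], by simp [h3, k3]⟩
  smul_mem' := by
    rintro c X ⟨hX, h1, h2, h3⟩
    exact ⟨asl.smul_mem c hX, by simp [h1], by simp [h2], by simp [h3]⟩
  lie_mem' := by
    rintro X Y ⟨hX, h1, h2, h3⟩ ⟨hY, k1, k2, k3⟩
    refine ⟨asl.lie_mem hX hY, ?_⟩
    simp [Ring.lie_def, Matrix.mul_apply, Fin.sum_univ_three, h1, h2, h3, k1, k2, k3]

/-! ### Differential forms on (open subsets of) normed spaces -/

section Forms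

variable {E : Type*} [NormedAddCommGroup E] [NormedSpace ℝ E]

/-- Wedge product of two 1-forms. -/
def wedge (α β : E → E →L[ℝ] ℝ) (e v w : E) : ℝ := α e v * β e w - α e w * β e v

/-- Exterior derivative of a 1-form. -/
def extd (α : E → E →L[ℝ] ℝ) (e v w : E) : ℝ := fderiv ℝ α e v w - fderiv ℝ α e w v

/-- `extd` is Mathlib's exterior derivative in degree one. -/
theorem extd_eq_extDeriv (α : E → E →L[ℝ] ℝ) (e v w : E) (h : DifferentiableAt ℝ α e) :
    extDeriv (fun x => ContinuousAlternatingMap.ofSubsingleton ℝ E ℝ (0 : Fin 1) (α x)) e ![v, w]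
      = extd α e v w := by
  set L := ContinuousAlternatingMap.ofSubsingletonLIE (𝕜 := ℝ) (E := E) (F := ℝ) (0 : Fin 1)
  have hd : HasFDerivAt (fun x => ContinuousAlternatingMap.ofSubsingleton ℝ E ℝ (0 : Fin 1) (α x))
      (L.toContinuousLinearEquiv.toContinuousLinearMap.comp (fderiv ℝ α e)) e :=
    L.toContinuousLinearEquiv.hasFDerivAt.comp e h.hasFDerivAt
  have hc : ∀ u : E, fderiv ℝ (fun x => α x u) e = (fderiv ℝ α e).flip u := fun u => by
    have := (h.hasFDerivAt.clm_apply (hasFDerivAt_const u e)).fderiv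
    simpa using this
  rw [extDeriv_apply hd.differentiableAt]
  simp [Fin.sum_univ_two, extd, Fin.removeNth, hc]
  ring

/-- The value on a tangent vector of a matrix of 1-forms. -/
def matEval (ω : Matrix (Fin 3) (Fin 3) (E → E →L[ℝ] ℝ)) (e v : E) : Mat3 :=
  Matrix.of fun i j => ω i j e v

/-- The curvature `dω + ω ∧ ω` of a matrix of 1-forms. -/
def curvature (ω : Matrix (Fin 3) (Fin 3) (E → E →L[ℝ] ℝ)) (i j : Fin 3) (e v w : E) : ℝ :=
  extd (ω i j) e v w + ∑ k, wedge (ω i k) (ω k j) e v w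

end Forms

/-! ### Jets, equations, area-preserving equivalence -/

/-- `J⁰(ℝ, ℝ)` with coordinates `(x, y)`. -/
abbrev J0 : Type := ℝ × ℝ

/-- `J¹(ℝ, ℝ)` with coordinates `q = (x, y, p)`, `p = y'`, so `x = q.1`, `y = q.2.1`,
`p = q.2.2`. -/
abbrev J1 : Type := ℝ × ℝ × ℝ

/-- The projection `J¹ → J⁰`. -/
def toJ0 (q : J1) : J0 := (q.1, q.2.1)

/-- `∂/∂y` on `J¹`. -/
def dY (g : J1 → ℝ) (q : J1) : ℝ := fderiv ℝ g q (0, 1, 0)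

/-- `∂/∂p` on `J¹`, where `p = y'`. -/
def dP (g : J1 → ℝ) (q : J1) : ℝ := fderiv ℝ g q (0, 0, 1)

/-- The total derivative `𝔇 = ∂_x + p ∂_y + f ∂_p`. -/
def totalD (f g : J1 → ℝ) (q : J1) : ℝ :=
  fderiv ℝ g q (1, 0, 0) + q.2.2 * dY g q + f q * dP g q

/-- The relative invariant `f_y + (2/9) f_p² - (1/3) 𝔇(f_p)`. -/
def relInv (f : J1 → ℝ) (q : J1) : ℝ :=
  dY f q + 2 / 9 * dP f q ^ 2 - 1 / 3 * totalD f (dP f) q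

/-- An equation `y'' = f(x, y, y')` on the open set `U ⊆ J¹`, with `f` real analytic on `U`, on
which the relative invariant vanishes identically. -/
structure IsSpecialODE (U : Set J1) (f : J1 → ℝ) : Prop where
  isOpen : IsOpen U
  analytic : AnalyticOnNhd ℝ f U
  relInv_eq_zero : ∀ q ∈ U, relInv f q = 0

/-- The 1-jet of `y` at `x`. -/
def jet1 (y : ℝ → ℝ) (x : ℝ) : J1 := (x, y x, deriv y x)

/-- `y` is a solution on the open interval `I` of the equation `y'' = f(x, y, y')` given on `V`. -/
structure IsSolution (V : Set J1) (f : J1 → ℝ) (I : Set ℝ) (y : ℝ → ℝ) : Prop where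
  isOpen : IsOpen I
  ordConnected : I.OrdConnected
  jet_mem : ∀ x ∈ I, jet1 y x ∈ V
  differentiableAt : ∀ x ∈ I, DifferentiableAt ℝ y x
  eqn : ∀ x ∈ I, HasDerivAt (deriv y) (f (jet1 y x)) x

/-- `χ_x + p χ_y` for `Φ = (χ, φ)`. -/
def prolongDen (Φ : J0 → J0) (q : J1) : ℝ := (fderiv ℝ Φ (toJ0 q) (1, q.2.2)).1

/-- The first prolongation of `Φ = (χ, φ)`:
`(x, y, p) ↦ (χ, φ, (φ_x + p φ_y) / (χ_x + p χ_y))`. -/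
def prolong (Φ : J0 → J0) (q : J1) : J1 :=
  ((Φ (toJ0 q)).1, (Φ (toJ0 q)).2, (fderiv ℝ Φ (toJ0 q) (1, q.2.2)).2 / prolongDen Φ q)

/-- The Jacobian `χ_x φ_y - χ_y φ_x` of `Φ = (χ, φ)`. -/
def jacobian (Φ : J0 → J0) (z : J0) : ℝ :=
  (fderiv ℝ Φ z (1, 0)).1 * (fderiv ℝ Φ z (0, 1)).2 -
    (fderiv ℝ Φ z (0, 1)).1 * (fderiv ℝ Φ z (1, 0)).2

/-- `Φ = (χ, φ)` is an area-preserving equivalence from `y'' = f` on `V` to `ȳ'' = f'` on `V'`: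
it is real analytic with Jacobian identically one, its first prolongation is defined on `V` and
maps `V` bijectively onto `V'` (its inverse is then analytic too), and `Φ` maps solutions (seen as
graphs) to solutions. -/
structure IsAreaEquiv (V : Set J1) (f : J1 → ℝ) (V' : Set J1) (f' : J1 → ℝ)
    (Φ : J0 → J0) : Prop where
  analytic : AnalyticOnNhd ℝ Φ (toJ0 '' V)
  jacobian_eq_one : ∀ z ∈ toJ0 '' V, jacobian Φ z = 1
  prolongDen_ne_zero : ∀ q ∈ V, prolongDen Φ q ≠ 0
  bijOn : BijOn (prolong Φ) V V'
  maps_solutions : ∀ (I : Set ℝ) (y : ℝ → ℝ), IsSolution V f I y →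
    ∃ (I' : Set ℝ) (y' : ℝ → ℝ), IsSolution V' f' I' y' ∧
      (fun x => Φ (x, y x)) '' I = (fun t => (t, y' t)) '' I'

/-! ### The `H`-bundle -/

/-- Coordinates `b = (x, y, p, u₁, u₃)`: `b.1 = (x, y, p)`, `b.2.1 = u₁`, `b.2.2 = u₃`. -/
abbrev Tot : Type := J1 × ℝ × ℝ

/-- The total space of the bundle over `U`; the point `(q, u₁, u₃)` stands for
`(q, hMat u₁ u₃) ∈ U × H`. -/
def bundle (U : Set J1) : Set Tot := {b | b.1 ∈ U ∧ b.2.1 ≠ 0}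

/-- The right action `(q, S) ↦ (q, S T)` of `T ∈ H` (see `hMat_act`). -/
def act (T : Mat3) (b : Tot) : Tot :=
  (b.1, b.2.1 * T 1 1, b.2.2 * T 2 2 - b.2.1 * T 1 2)

theorem hMat_act (T : Matrix.SpecialLinearGroup (Fin 3) ℝ) (hT : T ∈ H) (b : Tot) :
    hMat (act T b).2.1 (act T b).2.2 = hMat b.2.1 b.2.2 * (T : Mat3) := by
  obtain ⟨v₁, v₃, hv, h⟩ := (mem_H_iff T).1 hT
  simp only [act, h]
  ext i j
  fin_cases i <;> fin_cases j <;>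
    (simp [hMat, Matrix.mul_apply, Fin.sum_univ_three]; try ring)

/-- A (real analytic) principal right `H`-bundle with total space the open set `P ⊆ E`, base the
open set `M ⊆ N`, projection `π` and right action `R`; `H` carries its coordinates `(v₁, v₃)`. -/
structure IsPrincipalHBundle {E N : Type*} [NormedAddCommGroup E] [NormedSpace ℝ E]
    [NormedAddCommGroup N] [NormedSpace ℝ N] (P : Set E) (M : Set N) (π : E → N)
    (R : Mat3 → E → E) : Prop where
  isOpen_total : IsOpen P
  isOpen_base : IsOpen M
  proj_analytic : AnalyticOnNhd ℝ π P
  proj_mapsTo : MapsTo π P M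
  act_mem : ∀ T ∈ H, ∀ b ∈ P, R T b ∈ P
  act_one : ∀ b ∈ P, R 1 b = b
  act_mul : ∀ S ∈ H, ∀ T ∈ H, ∀ b ∈ P, R ((S * T : Matrix.SpecialLinearGroup (Fin 3) ℝ) : Mat3) b
    = R T (R S b)
  act_analytic : AnalyticOnNhd ℝ (fun z : E × ℝ × ℝ => R (hMat z.2.1 z.2.2) z.1)
    {z | z.1 ∈ P ∧ z.2.1 ≠ 0}
  proj_act : ∀ T ∈ H, ∀ b ∈ P, π (R T b) = π b
  /-- simply transitive on the fibres -/
  fibre : ∀ b ∈ P, ∀ b' ∈ P, π b = π b' → ∃! T, T ∈ H ∧ R T b = b'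
  /-- local triviality: a local section `σ`, and the `H`-coordinates `τ` of the corresponding
  trivialization, are analytic -/
  locallyTrivial : ∀ q ∈ M, ∃ (V : Set N) (σ : N → E) (τ : E → ℝ × ℝ), IsOpen V ∧ q ∈ V ∧ V ⊆ M ∧
    AnalyticOnNhd ℝ σ V ∧ MapsTo σ V P ∧ (∀ q' ∈ V, π (σ q') = q') ∧
    AnalyticOnNhd ℝ τ (P ∩ π ⁻¹' V) ∧
    ∀ b ∈ P ∩ π ⁻¹' V, (τ b).1 ≠ 0 ∧ R (hMat (τ b).1 (τ b).2) (σ (π b)) = b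

/-- The fundamental vector field `ρ(X)` of `X ∈ 𝔥`: `ρ(X)_b = d/dt|₀ b · exp(tX)`. -/
def fundVec (X : Mat3) (b : Tot) : Tot :=
  deriv (fun t : ℝ => act (NormedSpace.exp (t • X)) b) 0

/-- `ω` is a Cartan connection on the principal `H`-bundle `bundle U → U`, modeled on
`(𝔞𝔰𝔩(2, ℝ), 𝔥)`. -/
structure IsCartanConnection (U : Set J1)
    (ω : Matrix (Fin 3) (Fin 3) (Tot → Tot →L[ℝ] ℝ)) : Prop where
  smooth : ∀ i j, ContDiffOn ℝ (⊤ : ℕ∞) (ω i j) (bundle U)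
  /-- `ω_b` is a linear isomorphism onto `𝔞𝔰𝔩(2, ℝ)` -/
  iso : ∀ b ∈ bundle U, BijOn (matEval ω b) univ (asl : Set Mat3)
  /-- `R_T^* ω = Ad_{T⁻¹} ω` -/
  equivariant : ∀ T ∈ H, ∀ b ∈ bundle U, ∀ v,
    matEval ω (act T b) (fderiv ℝ (act T) b v) =
      ((T⁻¹ : Matrix.SpecialLinearGroup (Fin 3) ℝ) : Mat3) * matEval ω b v * (T : Mat3)
  fundamental : ∀ b ∈ bundle U, ∀ X ∈ hLie, matEval ω b (fundVec X b) = X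

/-! ### The coframe, the connection, the invariants -/

/-- `dx` on `J¹`. -/
def formX (_ : J1) : J1 →L[ℝ] ℝ := ContinuousLinearMap.fst ℝ ℝ (ℝ × ℝ)

/-- `dy` on `J¹`. -/
def formY (_ : J1) : J1 →L[ℝ] ℝ :=
  (ContinuousLinearMap.fst ℝ ℝ ℝ).comp (ContinuousLinearMap.snd ℝ ℝ (ℝ × ℝ))

/-- `dp` on `J¹`. -/
def formP (_ : J1) : J1 →L[ℝ] ℝ :=
  (ContinuousLinearMap.snd ℝ ℝ ℝ).comp (ContinuousLinearMap.snd ℝ ℝ (ℝ × ℝ))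

/-- The contact form `ω¹ = dy - p dx`. -/
def contact (q : J1) : J1 →L[ℝ] ℝ := formY q - q.2.2 • formX q

/-- The form `dp - f dx + μ (dy - p dx)`. -/
def formPi (f μ : J1 → ℝ) (q : J1) : J1 →L[ℝ] ℝ := formP q - f q • formX q + μ q • contact q

/-- Pull-back to the total space of a 1-form on `J¹`. -/
def pull (α : J1 → J1 →L[ℝ] ℝ) (b : Tot) : Tot →L[ℝ] ℝ :=
  (α b.1).comp (ContinuousLinearMap.fst ℝ J1 (ℝ × ℝ))

/-- `du₁`. -/
def formU1 (_ : Tot) : Tot →L[ℝ] ℝ :=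
  (ContinuousLinearMap.fst ℝ ℝ ℝ).comp (ContinuousLinearMap.snd ℝ J1 (ℝ × ℝ))

/-- `du₃`. -/
def formU3 (_ : Tot) : Tot →L[ℝ] ℝ :=
  (ContinuousLinearMap.snd ℝ ℝ ℝ).comp (ContinuousLinearMap.snd ℝ J1 (ℝ × ℝ))

/-- `θ¹ = u₁ (dy - p dx)`. -/
def theta1 (b : Tot) : Tot →L[ℝ] ℝ := b.2.1 • pull contact b

/-- `θ² = u₁² (dp - f dx - (1/3) f_p (dy - p dx))`. -/
def theta2 (f : J1 → ℝ) (b : Tot) : Tot →L[ℝ] ℝ :=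
  b.2.1 ^ 2 • pull (formPi f fun q => -(1 / 3) * dP f q) b

/-- `θ³ = u₃ (dy - p dx) + (1/u₁) dx`. -/
def theta3 (b : Tot) : Tot →L[ℝ] ℝ := b.2.2 • pull contact b + (1 / b.2.1) • pull formX b

/-- `Ω¹`. -/
def Omega1 (f : J1 → ℝ) (b : Tot) : Tot →L[ℝ] ℝ :=
  let u₁ := b.2.1
  let u₃ := b.2.2
  let fp := dP f b.1
  let fpp := dP (dP f) b.1
  (1 / u₁) • formU1 b + (u₃ / u₁) • theta2 f b + (1 / 3 * u₁ * fp) • theta3 b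
    + (1 / (6 * u₁) * (fpp - 2 * u₁ * u₃ * fp)) • theta1 b

/-- `Ω²`. -/
def Omega2 (f : J1 → ℝ) (b : Tot) : Tot →L[ℝ] ℝ :=
  let u₁ := b.2.1
  let u₃ := b.2.2
  let fp := dP f b.1
  let fpp := dP (dP f) b.1
  let fppp := dP (dP (dP f)) b.1
  (u₃ / u₁ ^ 2) • formU1 b + (1 / u₁) • formU3 b + (u₃ / u₁) ^ 2 • theta2 f b
    + (1 / 3 * u₃ * fp) • theta3 b
    - (1 / (6 * u₁) * (fpp - 2 * u₁ * u₃ * fp)) • theta3 b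
    + (-(2 / 3) * (u₃ ^ 2 / u₁) * fp - 1 / (6 * u₁ ^ 3) * fppp
        + 1 / 2 * (u₃ / u₁ ^ 2) * fpp) • theta1 b

/-- The Cartan connection of the equation `y'' = f`. -/
def cartanForm (f : J1 → ℝ) : Matrix (Fin 3) (Fin 3) (Tot → Tot →L[ℝ] ℝ) :=
  !![0, 0, 0;
     theta3, Omega1 f, -Omega2 f;
     theta1, theta2 f, -Omega1 f]

/-- `I₁`. -/
def inv1 (f : J1 → ℝ) (b : Tot) : ℝ :=
  -(1 / 3) * dY (dP f) b.1 - 1 / 18 * dP f b.1 * dP (dP f) b.1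
    + 1 / 6 * totalD f (dP (dP f)) b.1

/-- `I₂`. -/
def inv2 (f : J1 → ℝ) (b : Tot) : ℝ :=
  -(1 / (6 * b.2.1 ^ 5)) * dP (dP (dP (dP f))) b.1

/-- `I₃`. -/
def inv3 (f : J1 → ℝ) (b : Tot) : ℝ :=
  1 / b.2.1 ^ 2 * (1 / 6 * dY (dP (dP f)) b.1 - 1 / 6 * totalD f (dP (dP (dP f))) b.1
      - 1 / 9 * dP f b.1 * dP (dP (dP f)) b.1 + 1 / 18 * dP (dP f) b.1 ^ 2)
    + 2 * (b.2.2 / b.2.1) * inv1 f b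

/-- The right-hand side of the curvature formula, a matrix of 2-forms. -/
def curvatureRHS (f : J1 → ℝ) (b v w : Tot) : Mat3 :=
  let θ31 := wedge theta3 theta1 b v w
  let θ21 := wedge (theta2 f) theta1 b v w
  !![0, 0, 0;
     0, inv1 f b * θ31, -(inv2 f b * θ21) - inv3 f b * θ31;
     0, 0, -(inv1 f b * θ31)]

/-- The structure equations of the coframe `θ¹, θ², θ³, Ω¹, Ω²`: all structure functions are
constant, except for `I₁, I₂, I₃`. -/
structure StructureEquations (U : Set J1) (f : J1 → ℝ) : Prop where
  dtheta1 : ∀ b ∈ bundle U, ∀ v w, extd theta1 b v w =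
    wedge (Omega1 f) theta1 b v w + wedge theta3 (theta2 f) b v w
  dtheta2 : ∀ b ∈ bundle U, ∀ v w, extd (theta2 f) b v w =
    2 * wedge (Omega1 f) (theta2 f) b v w
  dtheta3 : ∀ b ∈ bundle U, ∀ v w, extd theta3 b v w =
    wedge (Omega2 f) theta1 b v w - wedge (Omega1 f) theta3 b v w
  dOmega1 : ∀ b ∈ bundle U, ∀ v w, extd (Omega1 f) b v w =
    wedge (Omega2 f) (theta2 f) b v w + inv1 f b * wedge theta3 theta1 b v w
  dOmega2 : ∀ b ∈ bundle U, ∀ v w, extd (Omega2 f) b v w =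
    2 * wedge (Omega2 f) (Omega1 f) b v w + inv2 f b * wedge (theta2 f) theta1 b v w
      + inv3 f b * wedge theta3 theta1 b v w

/-! ### Normal connections -/

/-- `η = s^* ω`, with `s` the section `q ↦ (q, e)`, i.e. `u₁ = 1`, `u₃ = 0`. -/
def sectionPull (ω : Matrix (Fin 3) (Fin 3) (Tot → Tot →L[ℝ] ℝ)) :
    Matrix (Fin 3) (Fin 3) (J1 → J1 →L[ℝ] ℝ) :=
  Matrix.of fun i j q =>
    (ω i j (q, 1, 0)).comp (ContinuousLinearMap.inl ℝ J1 (ℝ × ℝ))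

/-- The normalization conditions on a connection matrix `ω`, in terms of `η = s^* ω`:
the forms `η¹, η², η²₁` are `dx`, `dy - p dx` and `Π = dp - f dx + μ (dy - p dx)` for some
function `μ`; the torsions `Θ¹, Θ²` vanish; and in the expansions of `Θ¹₁` and `Θ²₁` with respect
to `η¹ ∧ Π`, `η² ∧ Π`, `η¹ ∧ η²` the coefficients of `η¹ ∧ Π` and `η² ∧ Π` vanish. -/
structure IsNormal (U : Set J1) (f : J1 → ℝ)
    (ω : Matrix (Fin 3) (Fin 3) (Tot → Tot →L[ℝ] ℝ)) : Prop where
  eta1 : ∀ q ∈ U, sectionPull ω 1 0 q = formX q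
  eta2 : ∀ q ∈ U, sectionPull ω 2 0 q = contact q
  eta21 : ∃ μ : J1 → ℝ, ∀ q ∈ U, sectionPull ω 2 1 q = formPi f μ q
  torsion1 : ∀ q ∈ U, ∀ v w, curvature (sectionPull ω) 1 0 q v w = 0
  torsion2 : ∀ q ∈ U, ∀ v w, curvature (sectionPull ω) 2 0 q v w = 0
  curv11 : ∃ r : J1 → ℝ, ∀ q ∈ U, ∀ v w,
    curvature (sectionPull ω) 1 1 q v w = r q * wedge formX contact q v w
  curv21 : ∃ r : J1 → ℝ, ∀ q ∈ U, ∀ v w,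
    curvature (sectionPull ω) 2 1 q v w = r q * wedge formX contact q v w

/-! ### Isomorphisms of Cartan geometries -/

/-- `F` is an isomorphism of `H`-bundles `bundle V → bundle V'`, i.e. it commutes with the right
action of `H`, and pulls the Cartan connection of `f'` back to that of `f`. -/
structure IsCartanIso (V : Set J1) (f : J1 → ℝ) (V' : Set J1) (f' : J1 → ℝ)
    (F : Tot → Tot) : Prop where
  analytic : AnalyticOnNhd ℝ F (bundle V)
  bijOn : BijOn F (bundle V) (bundle V')
  equivariant : ∀ T ∈ H, ∀ b ∈ bundle V, F (act T b) = act T (F b)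
  pullback : ∀ b ∈ bundle V, ∀ v,
    matEval (cartanForm f') (F b) (fderiv ℝ F b v) = matEval (cartanForm f) b v

end AreaPreservingODE

end

/-! The connection is forced by its normalization. Along the section q ↦ (q, e), with ω¹ = dy - p
dx, vanishing torsion gives η¹₁ = -μ dx + a ω¹ and η¹₂ = a dx + β ω¹ by the argument of Cartan's
lemma. The curvature conditions then give μ = -f_p/3, a = f_pp/6 and β = f_ppp/6 in turn
(`normal_eq_on_section`). Every point of the bundle is an H-translate of a point of the section, and
the vertical vectors are values of fundamental fields. So equivariance and reproduction of the
fundamental fields determine the matrix everywhere (`eq_of_eq_on_section`, combined in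
`normal_unique`).

That the resulting matrix is normal is a computation: `structureEquations` differentiates the
coframe, and (*) is used there as a formula for f_y. The curvature follows algebraically, and
normality is its restriction to the section.

An area-preserving equivalence Φ lifts to a bundle map `liftMap Φ`, with fibre coordinates chosen so
that θ¹ and θ³ correspond. Since Φ maps solutions to solutions, its prolongation preserves the line
field of the equation. The pull-back of the second connection is therefore again normal for the
first equation, and uniqueness identifies it with the first connection (`liftMap_pullback`); Ω¹ and
Ω² never have to be transformed by hand.

Conversely, an isomorphism F covers a map of the bases. Preservation of θ¹ and θ³
(`baseMap_pullback`) makes x̄ and ȳ constant along ∂_p, so with connected fibres they descend to a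
point map Φ. Preservation of the contact form up to scale makes the base map the prolongation of Φ.
The scales of dx and of the contact form are reciprocal modulo the contact form, so the Jacobian is
one. Finally θ² carries solutions to solutions. Locally, connectedness of the fibres is obtained by
shrinking to a ball. -/

noncomputable section

namespace AreaPreservingODE

/-! ### Calculus preliminaries -/

section Calculus

variable {E E' : Type*} [NormedAddCommGroup E] [NormedSpace ℝ E]
  [NormedAddCommGroup E'] [NormedSpace ℝ E']

/-- Reduces an exterior derivative to two derivatives of scalar functions of one real variable, with
the argument of the form held fixed. -/
theorem extd_eq_sub {α : E → E →L[ℝ] ℝ} {e v w : E} {A B : ℝ} (hα : DifferentiableAt ℝ α e)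
    (hA : HasDerivAt (fun t : ℝ => α (e + t • v) w) A 0)
    (hB : HasDerivAt (fun t : ℝ => α (e + t • w) v) B 0) : extd α e v w = A - B := by
  have key : ∀ a b : E, HasDerivAt (fun t : ℝ => α (e + t • a) b) (fderiv ℝ α e a b) 0 := by
    intro a b
    have h := hα.hasFDerivAt.clm_apply (hasFDerivAt_const b e)
    simpa [HasLineDerivAt] using h.hasLineDerivAt a
  rw [extd, (key v w).unique hA, (key w v).unique hB]

theorem extd_congr {α β : E → E →L[ℝ] ℝ} {e : E} (h : α =ᶠ[𝓝 e] β) (v w : E) :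
    extd α e v w = extd β e v w := by
  simp only [extd, h.fderiv_eq]

theorem extd_neg (α : E → E →L[ℝ] ℝ) (e v w : E) : extd (-α) e v w = -extd α e v w := by
  simp only [extd, fderiv_neg, _root_.neg_apply]
  ring

theorem extd_zero (e v w : E) : extd (0 : E → E →L[ℝ] ℝ) e v w = 0 := by
  simp [extd]

/-- Pull-back of a 1-form. -/
def pullForm (g : E → E') (α : E' → E' →L[ℝ] ℝ) (e : E) : E →L[ℝ] ℝ :=
  (α (g e)).comp (fderiv ℝ g e)

/-- The second derivative of g enters symmetrically in v and w, so it cancels in the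
antisymmetrization. -/
theorem extd_pullForm {g : E → E'} {α : E' → E' →L[ℝ] ℝ} {e : E} (hg : ContDiffAt ℝ 2 g e)
    (hα : DifferentiableAt ℝ α (g e)) (v w : E) :
    extd (pullForm g α) e v w = extd α (g e) (fderiv ℝ g e v) (fderiv ℝ g e w) := by
  have h1 : HasFDerivAt g (fderiv ℝ g e) e :=
    (hg.differentiableAt (by norm_num)).hasFDerivAt
  have h2 : HasFDerivAt (fderiv ℝ g) (fderiv ℝ (fderiv ℝ g) e) e :=
    ((hg.fderiv_right (m := 1) (by norm_num)).differentiableAt (by norm_num)).hasFDerivAt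
  have h3 : HasFDerivAt (fun x => α (g x)) _ e := hα.hasFDerivAt.comp e h1
  have h4 := (h3.clm_comp h2).fderiv
  have hs := hg.isSymmSndFDerivAt (by simp) v w
  unfold extd
  change fderiv ℝ (fun x => (α (g x)).comp (fderiv ℝ g x)) e v w -
    fderiv ℝ (fun x => (α (g x)).comp (fderiv ℝ g x)) e w v = _
  rw [h4]
  simp [hs]

theorem curvature_pullForm {g : E → E'} {ω : Matrix (Fin 3) (Fin 3) (E' → E' →L[ℝ] ℝ)} {e : E}
    (hg : ContDiffAt ℝ 2 g e) (hω : ∀ i j, DifferentiableAt ℝ (ω i j) (g e)) (i j : Fin 3)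
    (v w : E) :
    curvature (Matrix.of fun i j => pullForm g (ω i j)) i j e v w =
      curvature ω i j (g e) (fderiv ℝ g e v) (fderiv ℝ g e w) := by
  simp only [curvature, Matrix.of_apply, extd_pullForm hg (hω i j)]
  rfl

theorem curvature_congr {ω ω' : Matrix (Fin 3) (Fin 3) (E → E →L[ℝ] ℝ)} {e : E}
    (h : ∀ i j, ω i j =ᶠ[𝓝 e] ω' i j) (i j : Fin 3) (v w : E) :
    curvature ω i j e v w = curvature ω' i j e v w := by
  simp only [curvature, extd_congr (h i j), wedge, fun i j => (h i j).self_of_nhds]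

end Calculus

/-- `∂/∂x` on `J¹`. -/
def dX (g : J1 → ℝ) (q : J1) : ℝ := fderiv ℝ g q (1, 0, 0)

theorem fderiv_eq_partials (g : J1 → ℝ) (q v : J1) :
    fderiv ℝ g q v = v.1 * dX g q + v.2.1 * dY g q + v.2.2 * dP g q := by
  have : v = v.1 • ((1, 0, 0) : J1) + v.2.1 • ((0, 1, 0) : J1) + v.2.2 • ((0, 0, 1) : J1) := by
    ext <;> simp
  conv_lhs => rw [this]
  simp only [map_add, map_smul, smul_eq_mul, dX, dY, dP]

theorem totalD_eq (f g : J1 → ℝ) (q : J1) :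
    totalD f g q = dX g q + q.2.2 * dY g q + f q * dP g q := rfl

theorem analyticOnNhd_dP {g : J1 → ℝ} {U : Set J1} (h : AnalyticOnNhd ℝ g U) :
    AnalyticOnNhd ℝ (dP g) U := fun q hq =>
  (((ContinuousLinearMap.apply ℝ ℝ ((0, 0, 1) : J1)).analyticAt _).comp (h.fderiv q hq))

/-! ### Values of the basic forms -/

@[simp] theorem formX_apply (q v : J1) : formX q v = v.1 := rfl
@[simp] theorem contact_apply (q v : J1) : contact q v = v.2.1 - q.2.2 * v.1 := rfl
@[simp] theorem formPi_apply (f μ : J1 → ℝ) (q v : J1) :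
    formPi f μ q v = v.2.2 - f q * v.1 + μ q * (v.2.1 - q.2.2 * v.1) := rfl

theorem theta1_apply (b v : Tot) : theta1 b v = b.2.1 * (v.1.2.1 - b.1.2.2 * v.1.1) := rfl
theorem theta2_apply (f : J1 → ℝ) (b v : Tot) : theta2 f b v =
    b.2.1 ^ 2 * (v.1.2.2 - f b.1 * v.1.1 + -(1 / 3) * dP f b.1 * (v.1.2.1 - b.1.2.2 * v.1.1)) :=
  rfl
theorem theta3_apply (b v : Tot) : theta3 b v =
    b.2.2 * (v.1.2.1 - b.1.2.2 * v.1.1) + 1 / b.2.1 * v.1.1 := rfl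
theorem Omega1_apply (f : J1 → ℝ) (b v : Tot) : Omega1 f b v =
    1 / b.2.1 * v.2.1 + b.2.2 / b.2.1 * theta2 f b v + 1 / 3 * b.2.1 * dP f b.1 * theta3 b v
      + 1 / (6 * b.2.1) * (dP (dP f) b.1 - 2 * b.2.1 * b.2.2 * dP f b.1) * theta1 b v := rfl
theorem Omega2_apply (f : J1 → ℝ) (b v : Tot) : Omega2 f b v =
    b.2.2 / b.2.1 ^ 2 * v.2.1 + 1 / b.2.1 * v.2.2 + (b.2.2 / b.2.1) ^ 2 * theta2 f b v
      + 1 / 3 * b.2.2 * dP f b.1 * theta3 b v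
      - 1 / (6 * b.2.1) * (dP (dP f) b.1 - 2 * b.2.1 * b.2.2 * dP f b.1) * theta3 b v
      + (-(2 / 3) * (b.2.2 ^ 2 / b.2.1) * dP f b.1 - 1 / (6 * b.2.1 ^ 3) * dP (dP (dP f)) b.1
        + 1 / 2 * (b.2.2 / b.2.1 ^ 2) * dP (dP f) b.1) * theta1 b v := rfl

/-! ### Smoothness of the connection -/

theorem isOpen_bundle {U : Set J1} (hU : IsOpen U) : IsOpen (bundle U) :=
  (hU.preimage continuous_fst).inter
    (isOpen_ne.preimage (continuous_fst.comp continuous_snd))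

section Smooth

variable {f : J1 → ℝ} {b : Tot}

theorem contact_contDiff : ContDiff ℝ (⊤ : ℕ∞) contact := by
  unfold contact formY formX
  fun_prop

theorem pull_contDiffAt {α : J1 → J1 →L[ℝ] ℝ} (h : ContDiffAt ℝ (⊤ : ℕ∞) α b.1) :
    ContDiffAt ℝ (⊤ : ℕ∞) (pull α) b :=
  (h.comp b contDiffAt_fst).clm_comp contDiffAt_const

theorem formPi_contDiffAt {μ : J1 → ℝ} {q : J1} (hf : ContDiffAt ℝ (⊤ : ℕ∞) f q)
    (hμ : ContDiffAt ℝ (⊤ : ℕ∞) μ q) : ContDiffAt ℝ (⊤ : ℕ∞) (formPi f μ) q := by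
  have := contact_contDiff.contDiffAt (x := q)
  unfold formPi formP formX
  fun_prop

theorem theta1_contDiffAt : ContDiffAt ℝ (⊤ : ℕ∞) theta1 b := by
  have := pull_contDiffAt (b := b) contact_contDiff.contDiffAt
  unfold theta1
  fun_prop

theorem theta3_contDiffAt (hb : b.2.1 ≠ 0) : ContDiffAt ℝ (⊤ : ℕ∞) theta3 b := by
  have h1 := pull_contDiffAt (b := b) contact_contDiff.contDiffAt
  have h2 := pull_contDiffAt (b := b) (α := formX) contDiffAt_const
  unfold theta3
  fun_prop (disch := assumption)

theorem theta2_contDiffAt (hf : AnalyticAt ℝ f b.1) (hp : AnalyticAt ℝ (dP f) b.1) :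
    ContDiffAt ℝ (⊤ : ℕ∞) (theta2 f) b := by
  have h1 := pull_contDiffAt (b := b)
    (formPi_contDiffAt (μ := fun q => -(1 / 3) * dP f q) hf.contDiffAt
      (contDiffAt_const.mul hp.contDiffAt))
  unfold theta2
  fun_prop

theorem formU1_contDiffAt : ContDiffAt ℝ (⊤ : ℕ∞) formU1 b := contDiffAt_const
theorem formU3_contDiffAt : ContDiffAt ℝ (⊤ : ℕ∞) formU3 b := contDiffAt_const

theorem Omega1_contDiffAt (hb : b.2.1 ≠ 0) (hf : AnalyticAt ℝ f b.1)
    (hp : AnalyticAt ℝ (dP f) b.1) (hpp : AnalyticAt ℝ (dP (dP f)) b.1) :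
    ContDiffAt ℝ (⊤ : ℕ∞) (Omega1 f) b := by
  have h1 := theta1_contDiffAt (b := b)
  have h2 := theta2_contDiffAt hf hp
  have h3 := theta3_contDiffAt hb
  have h4 : ContDiffAt ℝ (⊤ : ℕ∞) (fun x : Tot => dP f x.1) b :=
    hp.contDiffAt.comp b contDiffAt_fst
  have h5 : ContDiffAt ℝ (⊤ : ℕ∞) (fun x : Tot => dP (dP f) x.1) b :=
    hpp.contDiffAt.comp b contDiffAt_fst
  have h6 := formU1_contDiffAt (b := b)
  have hb' : 6 * b.2.1 ≠ 0 := by simpa using hb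
  unfold Omega1
  dsimp only
  fun_prop (disch := assumption)

theorem Omega2_contDiffAt (hb : b.2.1 ≠ 0) (hf : AnalyticAt ℝ f b.1)
    (hp : AnalyticAt ℝ (dP f) b.1) (hpp : AnalyticAt ℝ (dP (dP f)) b.1)
    (hppp : AnalyticAt ℝ (dP (dP (dP f))) b.1) :
    ContDiffAt ℝ (⊤ : ℕ∞) (Omega2 f) b := by
  have h1 := theta1_contDiffAt (b := b)
  have h2 := theta2_contDiffAt hf hp
  have h3 := theta3_contDiffAt hb
  have h4 : ContDiffAt ℝ (⊤ : ℕ∞) (fun x : Tot => dP f x.1) b :=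
    hp.contDiffAt.comp b contDiffAt_fst
  have h5 : ContDiffAt ℝ (⊤ : ℕ∞) (fun x : Tot => dP (dP f) x.1) b :=
    hpp.contDiffAt.comp b contDiffAt_fst
  have h5' : ContDiffAt ℝ (⊤ : ℕ∞) (fun x : Tot => dP (dP (dP f)) x.1) b :=
    hppp.contDiffAt.comp b contDiffAt_fst
  have h6 := formU1_contDiffAt (b := b)
  have h7 := formU3_contDiffAt (b := b)
  have hb' : 6 * b.2.1 ≠ 0 := by simpa using hb
  have hb2 : b.2.1 ^ 2 ≠ 0 := pow_ne_zero _ hb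
  have hb3 : 6 * b.2.1 ^ 3 ≠ 0 := by simpa using hb
  unfold Omega2
  dsimp only
  fun_prop (disch := assumption)

end Smooth

theorem cartanForm_contDiffAt {U : Set J1} {f : J1 → ℝ} (hf : AnalyticOnNhd ℝ f U) {b : Tot}
    (hb : b ∈ bundle U) (i j : Fin 3) : ContDiffAt ℝ (⊤ : ℕ∞) (cartanForm f i j) b := by
  have h0 := hf b.1 hb.1
  have hp := analyticOnNhd_dP hf
  have hpp := analyticOnNhd_dP hp
  have h1 := hp b.1 hb.1
  have h2 := hpp b.1 hb.1
  have h3 := analyticOnNhd_dP hpp b.1 hb.1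
  fin_cases i <;> fin_cases j
  · exact contDiffAt_const
  · exact contDiffAt_const
  · exact contDiffAt_const
  · exact theta3_contDiffAt hb.2
  · exact Omega1_contDiffAt hb.2 h0 h1 h2
  · exact (Omega2_contDiffAt hb.2 h0 h1 h2 h3).neg
  · exact theta1_contDiffAt
  · exact theta2_contDiffAt h0 h1
  · exact (Omega1_contDiffAt hb.2 h0 h1 h2).neg

/-! ### Structure equations -/

section LineDerivatives

variable {f : J1 → ℝ} {b : Tot}

theorem hasDerivAt_base {g : J1 → ℝ} (hg : AnalyticAt ℝ g b.1) (v : Tot) :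
    HasDerivAt (fun t : ℝ => g (b + t • v).1)
      (v.1.1 * dX g b.1 + v.1.2.1 * dY g b.1 + v.1.2.2 * dP g b.1) 0 := by
  rw [← fderiv_eq_partials]
  exact hg.differentiableAt.hasFDerivAt.hasLineDerivAt v.1

theorem hasDerivAt_slope (v : Tot) : HasDerivAt (fun t : ℝ => (b + t • v).1.2.2) v.1.2.2 0 := by
  simpa using ((hasDerivAt_id (0 : ℝ)).mul_const v.1.2.2).const_add b.1.2.2

theorem hasDerivAt_u1 (v : Tot) : HasDerivAt (fun t : ℝ => (b + t • v).2.1) v.2.1 0 := by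
  simpa using ((hasDerivAt_id (0 : ℝ)).mul_const v.2.1).const_add b.2.1

theorem hasDerivAt_u3 (v : Tot) : HasDerivAt (fun t : ℝ => (b + t • v).2.2) v.2.2 0 := by
  simpa using ((hasDerivAt_id (0 : ℝ)).mul_const v.2.2).const_add b.2.2

theorem hasDerivAt_theta1 (v w : Tot) : HasDerivAt (fun t : ℝ => theta1 (b + t • v) w)
    (v.2.1 * (w.1.2.1 - b.1.2.2 * w.1.1) - b.2.1 * (v.1.2.2 * w.1.1)) 0 := by
  have hp := hasDerivAt_slope (b := b) v
  have h1 := hasDerivAt_u1 (b := b) v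
  simp only [theta1_apply]
  refine (h1.mul ((hasDerivAt_const (0 : ℝ) w.1.2.1).sub (hp.mul_const w.1.1))).congr_deriv ?_
  simp only [zero_smul, add_zero, Pi.sub_apply]
  ring

theorem hasDerivAt_theta3 (hb : b.2.1 ≠ 0) (v w : Tot) :
    HasDerivAt (fun t : ℝ => theta3 (b + t • v) w)
    (v.2.2 * (w.1.2.1 - b.1.2.2 * w.1.1) - b.2.2 * (v.1.2.2 * w.1.1)
      - v.2.1 / b.2.1 ^ 2 * w.1.1) 0 := by
  have hp := hasDerivAt_slope (b := b) v
  have h1 := hasDerivAt_u1 (b := b) v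
  have h3 := hasDerivAt_u3 (b := b) v
  simp only [theta3_apply, one_div]
  refine ((h3.mul ((hasDerivAt_const (0 : ℝ) w.1.2.1).sub (hp.mul_const w.1.1))).add
    ((h1.fun_inv (by simpa using hb)).mul_const w.1.1)).congr_deriv ?_
  simp only [zero_smul, add_zero, Pi.sub_apply]
  ring

theorem hasDerivAt_theta2 (hf : AnalyticAt ℝ f b.1) (hp : AnalyticAt ℝ (dP f) b.1) (v w : Tot) :
    HasDerivAt (fun t : ℝ => theta2 f (b + t • v) w)
    (2 * b.2.1 * v.2.1 *
        (w.1.2.2 - f b.1 * w.1.1 + -(1 / 3) * dP f b.1 * (w.1.2.1 - b.1.2.2 * w.1.1))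
      + b.2.1 ^ 2 * (-((v.1.1 * dX f b.1 + v.1.2.1 * dY f b.1 + v.1.2.2 * dP f b.1) * w.1.1)
        - 1 / 3 * (v.1.1 * dX (dP f) b.1 + v.1.2.1 * dY (dP f) b.1 + v.1.2.2 * dP (dP f) b.1)
            * (w.1.2.1 - b.1.2.2 * w.1.1)
        + 1 / 3 * dP f b.1 * (v.1.2.2 * w.1.1))) 0 := by
  have hs := hasDerivAt_slope (b := b) v
  have h1 := hasDerivAt_u1 (b := b) v
  have h4 := hasDerivAt_base hf v
  have h5 := hasDerivAt_base hp v
  simp only [theta2_apply]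
  refine ((h1.fun_pow 2).mul (((hasDerivAt_const (0 : ℝ) w.1.2.2).sub (h4.mul_const w.1.1)).add
    ((h5.const_mul (-(1 / 3))).mul
      ((hasDerivAt_const (0 : ℝ) w.1.2.1).sub (hs.mul_const w.1.1))))).congr_deriv ?_
  simp only [zero_smul, add_zero, Pi.mul_apply, Pi.sub_apply, Pi.add_apply]
  ring

/-- The derivatives of the θ's are parameters d1, d2, d3, so Ω¹ is differentiated as a combination
of the θ's without expanding them. -/
theorem hasDerivAt_Omega1 (hb : b.2.1 ≠ 0)
    (hp : AnalyticAt ℝ (dP f) b.1) (hpp : AnalyticAt ℝ (dP (dP f)) b.1)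
    (v w : Tot) {d1 d2 d3 : ℝ}
    (ht1 : HasDerivAt (fun t : ℝ => theta1 (b + t • v) w) d1 0)
    (ht2 : HasDerivAt (fun t : ℝ => theta2 f (b + t • v) w) d2 0)
    (ht3 : HasDerivAt (fun t : ℝ => theta3 (b + t • v) w) d3 0) :
    HasDerivAt (fun t : ℝ => Omega1 f (b + t • v) w)
    (-(v.2.1 / b.2.1 ^ 2) * w.2.1 + (v.2.2 / b.2.1 - b.2.2 * v.2.1 / b.2.1 ^ 2) * theta2 f b w
      + b.2.2 / b.2.1 * d2
      + 1 / 3 * (v.2.1 * dP f b.1 + b.2.1 * (v.1.1 * dX (dP f) b.1 + v.1.2.1 * dY (dP f) b.1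
          + v.1.2.2 * dP (dP f) b.1)) * theta3 b w
      + 1 / 3 * b.2.1 * dP f b.1 * d3
      + (1 / 6 * (v.1.1 * dX (dP (dP f)) b.1 + v.1.2.1 * dY (dP (dP f)) b.1
            + v.1.2.2 * dP (dP (dP f)) b.1) / b.2.1 - 1 / 6 * dP (dP f) b.1 * v.2.1 / b.2.1 ^ 2
          - 1 / 3 * v.2.2 * dP f b.1
          - 1 / 3 * b.2.2 * (v.1.1 * dX (dP f) b.1 + v.1.2.1 * dY (dP f) b.1
            + v.1.2.2 * dP (dP f) b.1)) * theta1 b w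
      + (1 / 6 * dP (dP f) b.1 / b.2.1 - 1 / 3 * b.2.2 * dP f b.1) * d1) 0 := by
  have h1 := hasDerivAt_u1 (b := b) v
  have h3 := hasDerivAt_u3 (b := b) v
  have h5 := hasDerivAt_base hp v
  have h6 := hasDerivAt_base hpp v
  have hb' : (b + (0 : ℝ) • v).2.1 ≠ 0 := by simpa using hb
  have hi := h1.fun_inv hb'
  -- All quotients become products with u₁⁻¹, so that the product rule and one derivative of an
  -- inverse suffice. The identity needs u₁ ≠ 0, which holds for small t.
  have e : ∀ t : ℝ, (b + t • v).2.1 ≠ 0 → Omega1 f (b + t • v) w =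
      (b + t • v).2.1⁻¹ * w.2.1
      + (b + t • v).2.2 * (b + t • v).2.1⁻¹ * theta2 f (b + t • v) w
      + 1 / 3 * ((b + t • v).2.1 * dP f (b + t • v).1) * theta3 (b + t • v) w
      + (1 / 6 * (dP (dP f) (b + t • v).1 * (b + t • v).2.1⁻¹)
        - 1 / 3 * ((b + t • v).2.2 * dP f (b + t • v).1)) * theta1 (b + t • v) w := by
    intro t ht
    rw [Omega1_apply]
    field_simp
    ring
  have hne : ∀ᶠ t : ℝ in 𝓝 0, (b + t • v).2.1 ≠ 0 := h1.continuousAt.eventually_ne hb'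
  refine HasDerivAt.congr_of_eventuallyEq (f := fun t : ℝ => _) ?_
    (hne.mono fun t ht => e t ht)
  refine ((((hi.mul_const w.2.1).add ((h3.mul hi).mul ht2)).add
    (((h1.mul h5).const_mul (1 / 3)).mul ht3)).add
    ((((h6.mul hi).const_mul (1 / 6)).sub ((h3.mul h5).const_mul (1 / 3))).mul ht1)).congr_deriv ?_
  simp only [zero_smul, add_zero, Pi.mul_apply, Pi.sub_apply]
  field_simp
  ring

theorem hasDerivAt_Omega2 (hb : b.2.1 ≠ 0)
    (hp : AnalyticAt ℝ (dP f) b.1) (hpp : AnalyticAt ℝ (dP (dP f)) b.1)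
    (hppp : AnalyticAt ℝ (dP (dP (dP f))) b.1)
    (v w : Tot) {d1 d2 d3 : ℝ}
    (ht1 : HasDerivAt (fun t : ℝ => theta1 (b + t • v) w) d1 0)
    (ht2 : HasDerivAt (fun t : ℝ => theta2 f (b + t • v) w) d2 0)
    (ht3 : HasDerivAt (fun t : ℝ => theta3 (b + t • v) w) d3 0) :
    HasDerivAt (fun t : ℝ => Omega2 f (b + t • v) w)
    ((v.2.2 / b.2.1 ^ 2 - 2 * b.2.2 * v.2.1 / b.2.1 ^ 3) * w.2.1 - v.2.1 / b.2.1 ^ 2 * w.2.2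
      + (2 * b.2.2 * v.2.2 / b.2.1 ^ 2 - 2 * b.2.2 ^ 2 * v.2.1 / b.2.1 ^ 3) * theta2 f b w
      + (b.2.2 / b.2.1) ^ 2 * d2
      + (2 / 3 * (v.2.2 * dP f b.1 + b.2.2 * (v.1.1 * dX (dP f) b.1 + v.1.2.1 * dY (dP f) b.1
          + v.1.2.2 * dP (dP f) b.1))
        - 1 / 6 * (v.1.1 * dX (dP (dP f)) b.1 + v.1.2.1 * dY (dP (dP f)) b.1
            + v.1.2.2 * dP (dP (dP f)) b.1) / b.2.1
        + 1 / 6 * dP (dP f) b.1 * v.2.1 / b.2.1 ^ 2) * theta3 b w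
      + (2 / 3 * b.2.2 * dP f b.1 - 1 / 6 * dP (dP f) b.1 / b.2.1) * d3
      + (-(2 / 3) * ((2 * b.2.2 * v.2.2 / b.2.1 - b.2.2 ^ 2 * v.2.1 / b.2.1 ^ 2) * dP f b.1
          + b.2.2 ^ 2 / b.2.1 * (v.1.1 * dX (dP f) b.1 + v.1.2.1 * dY (dP f) b.1
            + v.1.2.2 * dP (dP f) b.1))
        - 1 / 6 * ((v.1.1 * dX (dP (dP (dP f))) b.1 + v.1.2.1 * dY (dP (dP (dP f))) b.1
            + v.1.2.2 * dP (dP (dP (dP f))) b.1) / b.2.1 ^ 3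
          - 3 * dP (dP (dP f)) b.1 * v.2.1 / b.2.1 ^ 4)
        + 1 / 2 * ((v.2.2 / b.2.1 ^ 2 - 2 * b.2.2 * v.2.1 / b.2.1 ^ 3) * dP (dP f) b.1
          + b.2.2 / b.2.1 ^ 2 * (v.1.1 * dX (dP (dP f)) b.1 + v.1.2.1 * dY (dP (dP f)) b.1
            + v.1.2.2 * dP (dP (dP f)) b.1))) * theta1 b w
      + (-(2 / 3) * (b.2.2 ^ 2 / b.2.1) * dP f b.1 - 1 / (6 * b.2.1 ^ 3) * dP (dP (dP f)) b.1
        + 1 / 2 * (b.2.2 / b.2.1 ^ 2) * dP (dP f) b.1) * d1) 0 := by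
  have h1 := hasDerivAt_u1 (b := b) v
  have h3 := hasDerivAt_u3 (b := b) v
  have h5 := hasDerivAt_base hp v
  have h6 := hasDerivAt_base hpp v
  have h7 := hasDerivAt_base hppp v
  have hb' : (b + (0 : ℝ) • v).2.1 ≠ 0 := by simpa using hb
  have hi := h1.fun_inv hb'
  have e : ∀ t : ℝ, (b + t • v).2.1 ≠ 0 → Omega2 f (b + t • v) w =
      (b + t • v).2.2 * (b + t • v).2.1⁻¹ ^ 2 * w.2.1 + (b + t • v).2.1⁻¹ * w.2.2
      + ((b + t • v).2.2 ^ 2 * (b + t • v).2.1⁻¹ ^ 2) * theta2 f (b + t • v) w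
      + (2 / 3 * ((b + t • v).2.2 * dP f (b + t • v).1)
        - 1 / 6 * (dP (dP f) (b + t • v).1 * (b + t • v).2.1⁻¹)) * theta3 (b + t • v) w
      + (-(2 / 3) * ((b + t • v).2.2 ^ 2 * (b + t • v).2.1⁻¹ * dP f (b + t • v).1)
        - 1 / 6 * (dP (dP (dP f)) (b + t • v).1 * (b + t • v).2.1⁻¹ ^ 3)
        + 1 / 2 * ((b + t • v).2.2 * (b + t • v).2.1⁻¹ ^ 2 * dP (dP f) (b + t • v).1))
          * theta1 (b + t • v) w := by
    intro t ht
    rw [Omega2_apply]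
    field_simp
    ring
  have hne : ∀ᶠ t : ℝ in 𝓝 0, (b + t • v).2.1 ≠ 0 := h1.continuousAt.eventually_ne hb'
  refine HasDerivAt.congr_of_eventuallyEq (f := fun t : ℝ => _) ?_
    (hne.mono fun t ht => e t ht)
  refine ((((((h3.mul (hi.fun_pow 2)).mul_const w.2.1).add (hi.mul_const w.2.2)).add
    (((h3.fun_pow 2).mul (hi.fun_pow 2)).mul ht2)).add
    ((((h3.mul h5).const_mul (2 / 3)).sub ((h6.mul hi).const_mul (1 / 6))).mul ht3)).add
    ((((((h3.fun_pow 2).mul hi).mul h5).const_mul (-(2 / 3))).sub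
      ((h7.mul (hi.fun_pow 3)).const_mul (1 / 6))).add
      (((h3.mul (hi.fun_pow 2)).mul h6).const_mul (1 / 2)) |>.mul ht1)).congr_deriv ?_
  simp only [zero_smul, add_zero, Pi.mul_apply, Pi.sub_apply, Pi.add_apply, Nat.reduceSub,
    pow_one, Nat.cast_ofNat]
  field_simp
  ring

end LineDerivatives

/-- At a point, each equation is an identity between antisymmetric forms with coefficients rational
in u₁, u₃ and the partial derivatives of f. In every derivative that occurs, ∂_p is applied before
∂_x and ∂_y, so no partial derivatives have to be interchanged. -/
theorem structureEquations {U : Set J1} {f : J1 → ℝ} (h : IsSpecialODE U f) :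
    StructureEquations U f := by
  have an0 := h.analytic
  have an1 := analyticOnNhd_dP an0
  have an2 := analyticOnNhd_dP an1
  have an3 := analyticOnNhd_dP an2
  -- The condition (*) solved for f_y. Only f_y itself occurs below, not its derivatives, so (*) is
  -- never differentiated.
  have rel : ∀ b ∈ bundle U, dY f b.1 = 1 / 3 * (dX (dP f) b.1 + b.1.2.2 * dY (dP f) b.1
      + f b.1 * dP (dP f) b.1) - 2 / 9 * dP f b.1 ^ 2 := by
    intro b hb
    have := h.relInv_eq_zero b.1 hb.1
    rw [relInv, totalD_eq] at this
    linarith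
  constructor
  · intro b hb v w
    have hne := hb.2
    rw [extd_eq_sub (theta1_contDiffAt.differentiableAt (by simp))
      (hasDerivAt_theta1 v w) (hasDerivAt_theta1 w v)]
    simp only [wedge, Omega1_apply, theta1_apply, theta2_apply, theta3_apply]
    field_simp
    ring
  · intro b hb v w
    have hne := hb.2
    rw [extd_eq_sub ((theta2_contDiffAt (an0 _ hb.1) (an1 _ hb.1)).differentiableAt (by simp))
      (hasDerivAt_theta2 (an0 _ hb.1) (an1 _ hb.1) v w)
      (hasDerivAt_theta2 (an0 _ hb.1) (an1 _ hb.1) w v)]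
    simp only [wedge, Omega1_apply, theta1_apply, theta2_apply, theta3_apply, rel b hb]
    field_simp
    ring
  · intro b hb v w
    have hne := hb.2
    rw [extd_eq_sub ((theta3_contDiffAt hne).differentiableAt (by simp))
      (hasDerivAt_theta3 hne v w) (hasDerivAt_theta3 hne w v)]
    simp only [wedge, Omega1_apply, Omega2_apply, theta1_apply, theta2_apply, theta3_apply]
    field_simp
    ring
  · intro b hb v w
    have hne := hb.2
    have ht1 := hasDerivAt_theta1 (b := b)
    have ht2 := hasDerivAt_theta2 (an0 _ hb.1) (an1 _ hb.1)
    have ht3 := hasDerivAt_theta3 hne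
    rw [extd_eq_sub ((Omega1_contDiffAt hne (an0 _ hb.1) (an1 _ hb.1)
      (an2 _ hb.1)).differentiableAt (by simp))
      (hasDerivAt_Omega1 hne (an1 _ hb.1) (an2 _ hb.1) v w (ht1 v w) (ht2 v w)
        (ht3 v w))
      (hasDerivAt_Omega1 hne (an1 _ hb.1) (an2 _ hb.1) w v (ht1 w v) (ht2 w v)
        (ht3 w v))]
    simp only [wedge, Omega2_apply, theta1_apply, theta2_apply, theta3_apply, rel b hb,
      inv1, totalD_eq]
    field_simp
    ring
  · intro b hb v w
    have hne := hb.2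
    have ht1 := hasDerivAt_theta1 (b := b)
    have ht2 := hasDerivAt_theta2 (an0 _ hb.1) (an1 _ hb.1)
    have ht3 := hasDerivAt_theta3 hne
    rw [extd_eq_sub ((Omega2_contDiffAt hne (an0 _ hb.1) (an1 _ hb.1)
      (an2 _ hb.1) (an3 _ hb.1)).differentiableAt (by simp))
      (hasDerivAt_Omega2 hne (an1 _ hb.1) (an2 _ hb.1) (an3 _ hb.1) v w (ht1 v w)
        (ht2 v w) (ht3 v w))
      (hasDerivAt_Omega2 hne (an1 _ hb.1) (an2 _ hb.1) (an3 _ hb.1) w v (ht1 w v)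
        (ht2 w v) (ht3 w v))]
    simp only [wedge, Omega1_apply, Omega2_apply, theta1_apply, theta2_apply, theta3_apply,
      rel b hb, inv1, inv2, inv3, totalD_eq]
    field_simp
    ring

theorem curvature_cartanForm {U : Set J1} {f : J1 → ℝ} (h : IsSpecialODE U f) {b : Tot}
    (hb : b ∈ bundle U) (v w : Tot) (i j : Fin 3) :
    curvature (cartanForm f) i j b v w = curvatureRHS f b v w i j := by
  obtain ⟨s1, s2, s3, s4, s5⟩ := structureEquations h
  have t1 := s1 b hb v w
  have t2 := s2 b hb v w
  have t3 := s3 b hb v w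
  have t4 := s4 b hb v w
  have t5 := s5 b hb v w
  fin_cases i <;> fin_cases j <;>
    simp [curvature, cartanForm, curvatureRHS, Fin.sum_univ_three, extd_zero, extd_neg, t1, t2, t3,
      t4, t5] <;>
    simp [wedge] <;> ring

/-! ### The principal bundle -/

/-- The element of `SL(3, ℝ)` with matrix `hMat v₁ v₃`. -/
def hElt (v₁ v₃ : ℝ) (h : v₁ ≠ 0) : Matrix.SpecialLinearGroup (Fin 3) ℝ :=
  ⟨hMat v₁ v₃, by rw [Matrix.det_fin_three]; simp [hMat, h]⟩

theorem coe_hElt (v₁ v₃ : ℝ) (h : v₁ ≠ 0) : (hElt v₁ v₃ h : Mat3) = hMat v₁ v₃ := rfl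

theorem hElt_mem (v₁ v₃ : ℝ) (h : v₁ ≠ 0) : hElt v₁ v₃ h ∈ H :=
  (mem_H_iff _).2 ⟨v₁, v₃, h, rfl⟩

theorem act_hMat (v₁ v₃ : ℝ) (b : Tot) :
    act (hMat v₁ v₃) b = (b.1, b.2.1 * v₁, b.2.2 / v₁ + b.2.1 * v₃) := by
  simp [act, hMat]
  ring

theorem act_mem_bundle {U : Set J1} {T : Matrix.SpecialLinearGroup (Fin 3) ℝ} (hT : T ∈ H)
    {b : Tot} (hb : b ∈ bundle U) : act T b ∈ bundle U := by
  obtain ⟨v₁, v₃, hv, h⟩ := (mem_H_iff T).1 hT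
  rw [h, act_hMat]
  exact ⟨hb.1, mul_ne_zero hb.2 hv⟩

theorem exists_act_eq {U : Set J1} {b b' : Tot} (hb : b ∈ bundle U) (hb' : b' ∈ bundle U)
    (h : b.1 = b'.1) : ∃ T ∈ H, act T b = b' := by
  have h1 := hb.2
  have h2 := hb'.2
  -- The solution (v₁, v₃) of u₁ v₁ = u₁' and u₃ / v₁ + u₁ v₃ = u₃'.
  refine ⟨hElt (b'.2.1 / b.2.1) ((b'.2.2 - b.2.2 * b.2.1 / b'.2.1) / b.2.1) (div_ne_zero h2 h1),
    hElt_mem _ _ _, ?_⟩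
  rw [coe_hElt, act_hMat]
  ext1
  · exact h
  · ext1
    · dsimp only
      field_simp
    · dsimp only
      field_simp
      ring

theorem isPrincipalHBundle {U : Set J1} (hU : IsOpen U) :
    IsPrincipalHBundle (bundle U) U Prod.fst act where
  isOpen_total := isOpen_bundle hU
  isOpen_base := hU
  proj_analytic := fun _ _ => analyticAt_fst
  proj_mapsTo := fun _ hb => hb.1
  act_mem := fun _ hT _ hb => act_mem_bundle hT hb
  act_one := fun b _ => by simp [act]
  act_mul := by
    intro S hS T hT b _
    obtain ⟨v₁, v₃, hv, h⟩ := (mem_H_iff T).1 hT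
    obtain ⟨w₁, w₃, hw, h'⟩ := (mem_H_iff S).1 hS
    rw [Matrix.SpecialLinearGroup.coe_mul, h, h', act_hMat, act_hMat]
    simp only [act, hMat, Matrix.mul_apply, Fin.sum_univ_three]
    simp
    constructor <;> ring
  act_analytic := by
    intro z hz
    have hz2 : z.2.1 ≠ 0 := hz.2
    simp only [act_hMat]
    have a1 : AnalyticAt ℝ (fun z : Tot × ℝ × ℝ => z.1) z := analyticAt_fst
    have a2 : AnalyticAt ℝ (fun z : Tot × ℝ × ℝ => z.2) z := analyticAt_snd
    have a12 := analyticAt_snd.fun_comp a1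
    exact (analyticAt_fst.fun_comp a1).prod (((analyticAt_fst.fun_comp a12).mul
      (analyticAt_fst.fun_comp a2)).prod (((analyticAt_snd.fun_comp a12).div
        (analyticAt_fst.fun_comp a2) hz2).add ((analyticAt_fst.fun_comp a12).mul
          (analyticAt_snd.fun_comp a2))))
  proj_act := fun _ _ _ _ => rfl
  fibre := by
    intro b hb b' hb' h
    obtain ⟨T, hT, hTb⟩ := exists_act_eq hb hb' h
    refine ⟨T, ⟨hT, hTb⟩, ?_⟩
    rintro S ⟨hS, hSb⟩
    obtain ⟨v₁, v₃, hv, h⟩ := (mem_H_iff T).1 hT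
    obtain ⟨w₁, w₃, hw, h'⟩ := (mem_H_iff S).1 hS
    rw [← hTb, h, h', act_hMat, act_hMat] at hSb
    simp only [Prod.mk.injEq, true_and] at hSb
    have e1 : w₁ = v₁ := mul_left_cancel₀ hb.2 hSb.1
    subst e1
    have e2 : w₃ = v₃ := mul_left_cancel₀ hb.2 (add_left_cancel hSb.2)
    subst e2
    exact Subtype.ext (h'.trans h.symm)
  locallyTrivial := by
    intro q hq
    refine ⟨U, fun q => (q, 1, 0), fun b => b.2, hU, hq, Subset.rfl, fun q _ => by fun_prop,
      fun q hq => ⟨hq, one_ne_zero⟩, fun _ _ => rfl, fun b _ => analyticAt_snd, ?_⟩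
    rintro b ⟨hb, -⟩
    refine ⟨hb.2, ?_⟩
    rw [act_hMat]
    simp

/-! ### The action and the fundamental vector fields -/

/-- The action of a matrix on the total space as a continuous linear map. -/
def actL (T : Mat3) : Tot →L[ℝ] Tot :=
  LinearMap.toContinuousLinearMap
    { toFun := act T
      map_add' := fun b c => by
        simp only [act, Prod.fst_add, Prod.snd_add, Prod.mk_add_mk]
        ext <;> simp <;> ring
      map_smul' := fun r b => by
        simp only [act, Prod.smul_fst, Prod.smul_snd, RingHom.id_apply, Prod.smul_mk, smul_eq_mul]
        ext <;> simp <;> ring }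

theorem hasFDerivAt_act (T : Mat3) (b : Tot) : HasFDerivAt (act T) (actL T) b :=
  (actL T).hasFDerivAt

theorem fderiv_act (T : Mat3) (b v : Tot) : fderiv ℝ (act T) b v = act T v := by
  rw [(hasFDerivAt_act T b).fderiv]
  rfl

theorem hasDerivAt_exp_entry (X : Mat3) (i j : Fin 3) :
    HasDerivAt (fun t : ℝ => NormedSpace.exp (t • X) i j) (X i j) 0 := by
  -- The exponential is differentiated in the Banach algebra of matrices with this norm; taking an
  -- entry is a continuous linear map.
  let _ := Matrix.linftyOpNormedRing (n := Fin 3) (α := ℝ)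
  let _ := Matrix.linftyOpNormedAlgebra (n := Fin 3) (R := ℝ) (α := ℝ)
  have h := hasDerivAt_exp_smul_const (𝕂 := ℝ) X 0
  have h2 := (LinearMap.toContinuousLinearMap
    (Matrix.entryLinearMap ℝ ℝ i j : Mat3 →ₗ[ℝ] ℝ)).hasFDerivAt.comp_hasDerivAt _ h
  rw [zero_smul, NormedSpace.exp_zero, one_mul] at h2
  exact h2

/-- The action is linear in the entries of T on the fibre coordinates, so differentiating replaces
the entries of exp(tX) by those of X. -/
theorem fundVec_eq (X : Mat3) (b : Tot) :
    fundVec X b = (0, b.2.1 * X 1 1, b.2.2 * X 2 2 - b.2.1 * X 1 2) := by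
  have h := fun i j => hasDerivAt_exp_entry X i j
  exact ((hasDerivAt_const (0 : ℝ) b.1).prodMk (((h 1 1).const_mul b.2.1).prodMk
    (((h 2 2).const_mul b.2.2).sub ((h 1 2).const_mul b.2.1)))).deriv

theorem matEval_add {E : Type*} [NormedAddCommGroup E] [NormedSpace ℝ E]
    (ω : Matrix (Fin 3) (Fin 3) (E → E →L[ℝ] ℝ)) (e v w : E) :
    matEval ω e (v + w) = matEval ω e v + matEval ω e w := by
  ext i j
  simp [matEval]

theorem matEval_cartanForm (f : J1 → ℝ) (b v : Tot) : matEval (cartanForm f) b v =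
    !![0, 0, 0; theta3 b v, Omega1 f b v, -Omega2 f b v;
       theta1 b v, theta2 f b v, -Omega1 f b v] := by
  ext i j
  fin_cases i <;> fin_cases j <;> rfl

/-- The coframe `θ¹, θ², θ³, Ω¹, Ω²` as a linear automorphism: the vector with given values. -/
def coframeInv (f : J1 → ℝ) (b : Tot) (t1 t2 t3 o1 o2 : ℝ) : Tot :=
  let c := t1 / b.2.1
  let x := b.2.1 * (t3 - b.2.2 * c)
  let u := b.2.1 * (o1 - b.2.2 / b.2.1 * t2 - 1 / 3 * b.2.1 * dP f b.1 * t3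
    - 1 / (6 * b.2.1) * (dP (dP f) b.1 - 2 * b.2.1 * b.2.2 * dP f b.1) * t1)
  ((x, c + b.1.2.2 * x, t2 / b.2.1 ^ 2 + f b.1 * x + 1 / 3 * dP f b.1 * c), u,
    b.2.1 * (o2 - b.2.2 / b.2.1 ^ 2 * u - (b.2.2 / b.2.1) ^ 2 * t2
      - 1 / 3 * b.2.2 * dP f b.1 * t3
      + 1 / (6 * b.2.1) * (dP (dP f) b.1 - 2 * b.2.1 * b.2.2 * dP f b.1) * t3
      - (-(2 / 3) * (b.2.2 ^ 2 / b.2.1) * dP f b.1 - 1 / (6 * b.2.1 ^ 3) * dP (dP (dP f)) b.1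
        + 1 / 2 * (b.2.2 / b.2.1 ^ 2) * dP (dP f) b.1) * t1))

section Coframe

variable (f : J1 → ℝ) {b : Tot} (t1 t2 t3 o1 o2 : ℝ)

theorem theta1_coframeInv (hb : b.2.1 ≠ 0) :
    theta1 b (coframeInv f b t1 t2 t3 o1 o2) = t1 := by
  simp only [theta1_apply, coframeInv]
  field_simp
  ring

theorem theta2_coframeInv (hb : b.2.1 ≠ 0) :
    theta2 f b (coframeInv f b t1 t2 t3 o1 o2) = t2 := by
  simp only [theta2_apply, coframeInv]
  field_simp
  ring

theorem theta3_coframeInv (hb : b.2.1 ≠ 0) :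
    theta3 b (coframeInv f b t1 t2 t3 o1 o2) = t3 := by
  simp only [theta3_apply, coframeInv]
  field_simp
  ring

theorem Omega1_coframeInv (hb : b.2.1 ≠ 0) :
    Omega1 f b (coframeInv f b t1 t2 t3 o1 o2) = o1 := by
  rw [Omega1_apply, theta1_coframeInv _ _ _ _ _ _ hb, theta2_coframeInv _ _ _ _ _ _ hb, theta3_coframeInv _ _ _ _ _ _ hb]
  simp only [coframeInv]
  field_simp
  ring

theorem Omega2_coframeInv (hb : b.2.1 ≠ 0) :
    Omega2 f b (coframeInv f b t1 t2 t3 o1 o2) = o2 := by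
  rw [Omega2_apply, theta1_coframeInv _ _ _ _ _ _ hb, theta2_coframeInv _ _ _ _ _ _ hb, theta3_coframeInv _ _ _ _ _ _ hb]
  simp only [coframeInv]
  field_simp
  ring

end Coframe

/-- The coframe is triangular: θ¹, θ³, θ², Ω¹, Ω², in this order, successively kill the components
of v along dy - p dx, dx, dp, du₁, du₃. -/
theorem eq_zero_of_coframe (f : J1 → ℝ) {b : Tot} (hb : b.2.1 ≠ 0) {v : Tot}
    (h1 : theta1 b v = 0) (h2 : theta2 f b v = 0) (h3 : theta3 b v = 0) (h4 : Omega1 f b v = 0)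
    (h5 : Omega2 f b v = 0) : v = 0 := by
  rw [Omega1_apply, h1, h2, h3] at h4
  rw [Omega2_apply, h1, h2, h3] at h5
  rw [theta1_apply] at h1
  have hc : v.1.2.1 - b.1.2.2 * v.1.1 = 0 := (mul_eq_zero.1 h1).resolve_left hb
  rw [theta3_apply, hc] at h3
  have hx : v.1.1 = 0 := by simpa [hb] using h3
  rw [theta2_apply, hc, hx] at h2
  have hp : v.1.2.2 = 0 := by simpa [hb] using h2
  have hu : v.2.1 = 0 := by simpa [hb] using h4
  have hw : v.2.2 = 0 := by simpa [hb, hu] using h5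
  have hy : v.1.2.1 = 0 := by simpa [hx] using hc
  ext <;> simp [hx, hy, hp, hu, hw]

/-! ### The Cartan connection -/

theorem cartanForm_mem_asl (f : J1 → ℝ) (b v : Tot) : matEval (cartanForm f) b v ∈ asl := by
  rw [matEval_cartanForm]
  exact ⟨by simp, by simp, by simp, by simp⟩

theorem cartanForm_equivariant (f : J1 → ℝ) {T : Matrix.SpecialLinearGroup (Fin 3) ℝ}
    (hT : T ∈ H) {b : Tot} (hb : b.2.1 ≠ 0) (v : Tot) :
    matEval (cartanForm f) (act T b) (fderiv ℝ (act T) b v) =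
      ((T⁻¹ : Matrix.SpecialLinearGroup (Fin 3) ℝ) : Mat3) * matEval (cartanForm f) b v
        * (T : Mat3) := by
  -- Multiplying by T on the left leaves an entrywise identity free of the inverse matrix.
  have key : (T : Mat3) * matEval (cartanForm f) (act T b) (fderiv ℝ (act T) b v) =
      matEval (cartanForm f) b v * (T : Mat3) := by
    obtain ⟨v₁, v₃, hv, h⟩ := (mem_H_iff T).1 hT
    rw [fderiv_act, h, act_hMat, act_hMat, matEval_cartanForm, matEval_cartanForm]
    ext i j
    fin_cases i <;> fin_cases j <;>
      simp [hMat, Matrix.mul_apply, Fin.sum_univ_three, Omega1_apply, Omega2_apply, theta1_apply,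
        theta2_apply, theta3_apply] <;>
      field_simp <;> ring
  have hinv : ((T⁻¹ : Matrix.SpecialLinearGroup (Fin 3) ℝ) : Mat3) * (T : Mat3) = 1 := by
    rw [← Matrix.SpecialLinearGroup.coe_mul, inv_mul_cancel, Matrix.SpecialLinearGroup.coe_one]
  rw [Matrix.mul_assoc, ← key, ← Matrix.mul_assoc, hinv, Matrix.one_mul]

theorem isCartanConnection {U : Set J1} {f : J1 → ℝ} (hf : AnalyticOnNhd ℝ f U) :
    IsCartanConnection U (cartanForm f) where
  smooth := fun i j _ hb => (cartanForm_contDiffAt hf hb i j).contDiffWithinAt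
  iso := by
    intro b hb
    refine ⟨fun v _ => cartanForm_mem_asl f b v, ?_, ?_⟩
    · intro v _ w _ h
      rw [matEval_cartanForm, matEval_cartanForm] at h
      have e := fun i j => congrFun (congrFun h i) j
      have e1 := e 2 0
      have e2 := e 2 1
      have e3 := e 1 0
      have e4 := e 1 1
      have e5 := e 1 2
      simp at e1 e2 e3 e4 e5
      rw [← sub_eq_zero]
      apply eq_zero_of_coframe f hb.2 <;> simp [*]
    · rintro X ⟨h1, h2, h3, h4⟩
      refine ⟨coframeInv f b (X 2 0) (X 2 1) (X 1 0) (X 1 1) (-X 1 2), mem_univ _, ?_⟩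
      rw [matEval_cartanForm, theta1_coframeInv _ _ _ _ _ _ hb.2, theta2_coframeInv _ _ _ _ _ _ hb.2,
        theta3_coframeInv _ _ _ _ _ _ hb.2, Omega1_coframeInv _ _ _ _ _ _ hb.2, Omega2_coframeInv _ _ _ _ _ _ hb.2]
      ext i j
      fin_cases i <;> fin_cases j <;> simp [h1, h2, h3]
      linarith
  equivariant := fun T hT b hb v => cartanForm_equivariant f hT hb.2 v
  fundamental := by
    rintro b hb X ⟨⟨h1, h2, h3, h4⟩, h5, h6, h7⟩
    have hne := hb.2
    have h8 : X 2 2 = -X 1 1 := by linarith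
    rw [matEval_cartanForm, fundVec_eq]
    ext i j
    fin_cases i <;> fin_cases j <;>
      simp [h1, h2, h3, h5, h6, h7, h8, Omega1_apply, Omega2_apply, theta1_apply,
        theta2_apply, theta3_apply] <;> field_simp
    ring

/-! ### Normality -/

/-- The section `q ↦ (q, e)`. -/
def unitSection (q : J1) : Tot := (q, 1, 0)

theorem hasFDerivAt_unitSection (q : J1) :
    HasFDerivAt unitSection (ContinuousLinearMap.inl ℝ J1 (ℝ × ℝ)) q :=
  hasFDerivAt_prodMk_left q ((1, 0) : ℝ × ℝ)

theorem fderiv_unitSection (q v : J1) : fderiv ℝ unitSection q v = (v, 0) := by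
  rw [(hasFDerivAt_unitSection q).fderiv]
  rfl

theorem unitSection_mem {U : Set J1} {q : J1} (hq : q ∈ U) : unitSection q ∈ bundle U :=
  ⟨hq, one_ne_zero⟩

theorem contDiff_unitSection {n : WithTop ℕ∞} : ContDiff ℝ n unitSection :=
  contDiff_id.prodMk contDiff_const

theorem sectionPull_eq_pullForm (ω : Matrix (Fin 3) (Fin 3) (Tot → Tot →L[ℝ] ℝ)) :
    sectionPull ω = Matrix.of fun i j => pullForm unitSection (ω i j) := by
  refine Matrix.ext fun i j => funext fun q => ?_
  simp only [sectionPull, Matrix.of_apply, pullForm, (hasFDerivAt_unitSection q).fderiv]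
  rfl

theorem sectionPull_apply (ω : Matrix (Fin 3) (Fin 3) (Tot → Tot →L[ℝ] ℝ)) (i j : Fin 3)
    (q v : J1) : sectionPull ω i j q v = matEval ω (unitSection q) (v, 0) i j := rfl

theorem curvature_sectionPull {ω : Matrix (Fin 3) (Fin 3) (Tot → Tot →L[ℝ] ℝ)} {q : J1}
    (hω : ∀ i j, DifferentiableAt ℝ (ω i j) (unitSection q)) (i j : Fin 3) (v w : J1) :
    curvature (sectionPull ω) i j q v w = curvature ω i j (unitSection q) (v, 0) (w, 0) := by
  rw [sectionPull_eq_pullForm, curvature_pullForm contDiff_unitSection.contDiffAt hω,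
    fderiv_unitSection, fderiv_unitSection]

theorem theta1_unitSection (q v : J1) : theta1 (unitSection q) (v, 0) = contact q v := by
  simp [theta1_apply, unitSection]

theorem theta3_unitSection (q v : J1) : theta3 (unitSection q) (v, 0) = formX q v := by
  simp [theta3_apply, unitSection]

theorem theta2_unitSection (f : J1 → ℝ) (q v : J1) :
    theta2 f (unitSection q) (v, 0) = formPi f (fun q => -(1 / 3) * dP f q) q v := by
  simp [theta2_apply, unitSection]

theorem Omega1_unitSection (f : J1 → ℝ) (q v : J1) : Omega1 f (unitSection q) (v, 0) =
    1 / 3 * dP f q * v.1 + 1 / 6 * dP (dP f) q * contact q v := by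
  rw [Omega1_apply, theta1_unitSection, theta3_unitSection]
  simp [unitSection]

theorem Omega2_unitSection (f : J1 → ℝ) (q v : J1) : Omega2 f (unitSection q) (v, 0) =
    -(1 / 6 * dP (dP f) q * v.1) - 1 / 6 * dP (dP (dP f)) q * contact q v := by
  rw [Omega2_apply, theta1_unitSection, theta3_unitSection]
  simp [unitSection]
  ring

theorem cartanForm_differentiableAt {U : Set J1} {f : J1 → ℝ} (hf : AnalyticOnNhd ℝ f U)
    {b : Tot} (hb : b ∈ bundle U) (i j : Fin 3) : DifferentiableAt ℝ (cartanForm f i j) b :=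
  (cartanForm_contDiffAt hf hb i j).differentiableAt (by simp)

/-- Along the section θ³ and θ¹ become dx and dy - p dx, so the conditions are read off from the
curvature matrix: its first column and its entry Θ²₁ are zero, and Θ¹₁ is a multiple of θ³ ∧ θ¹. -/
theorem isNormal_cartanForm {U : Set J1} {f : J1 → ℝ} (h : IsSpecialODE U f) :
    IsNormal U f (cartanForm f) := by
  have hc : ∀ q ∈ U, ∀ i j v w, curvature (sectionPull (cartanForm f)) i j q v w =
      curvatureRHS f (unitSection q) (v, 0) (w, 0) i j := fun q hq i j v w => by
    rw [curvature_sectionPull (cartanForm_differentiableAt h.analytic (unitSection_mem hq)),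
      curvature_cartanForm h (unitSection_mem hq)]
  constructor
  · exact fun q _ => ContinuousLinearMap.ext fun v => theta3_unitSection q v
  · exact fun q _ => ContinuousLinearMap.ext fun v => theta1_unitSection q v
  · exact ⟨_, fun q _ => ContinuousLinearMap.ext fun v => theta2_unitSection f q v⟩
  · intro q hq v w
    rw [hc q hq]
    simp [curvatureRHS]
  · intro q hq v w
    rw [hc q hq]
    simp [curvatureRHS]
  · refine ⟨fun q => inv1 f (unitSection q), fun q hq v w => ?_⟩
    rw [hc q hq]
    simp [curvatureRHS, wedge, theta1_unitSection, theta3_unitSection]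
  · refine ⟨fun q => 0, fun q hq v w => ?_⟩
    rw [hc q hq]
    simp [curvatureRHS]

/-! ### Uniqueness of the normal connection -/

section ExteriorDerivatives

variable {f g h : J1 → ℝ} {q : J1}

theorem hasFDerivAt_slope : HasFDerivAt (fun q : J1 => q.2.2)
    ((ContinuousLinearMap.snd ℝ ℝ ℝ).comp (ContinuousLinearMap.snd ℝ ℝ (ℝ × ℝ))) q :=
  ((ContinuousLinearMap.snd ℝ ℝ ℝ).comp (ContinuousLinearMap.snd ℝ ℝ (ℝ × ℝ))).hasFDerivAt

theorem hasFDerivAt_contact : HasFDerivAt contact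
    (-(((ContinuousLinearMap.snd ℝ ℝ ℝ).comp (ContinuousLinearMap.snd ℝ ℝ (ℝ × ℝ))).smulRight
      (formX q))) q := by
  have := (hasFDerivAt_slope (q := q)).smul_const (formX q)
  exact this.const_sub (formY q)

theorem extd_formX_contact (hg : DifferentiableAt ℝ g q) (hh : DifferentiableAt ℝ h q)
    (v w : J1) : extd (fun q => g q • formX q + h q • contact q) q v w =
      fderiv ℝ g q v * w.1 - fderiv ℝ g q w * v.1
        + fderiv ℝ h q v * contact q w - fderiv ℝ h q w * contact q v
        + h q * (v.1 * w.2.2 - w.1 * v.2.2) := by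
  have h1 := (hg.hasFDerivAt.smul_const (formX q)).fun_add
    (hh.hasFDerivAt.fun_smul (hasFDerivAt_contact (q := q)))
  rw [extd]
  change fderiv ℝ (fun q' => g q' • formX q + h q' • contact q') q v w -
    fderiv ℝ (fun q' => g q' • formX q + h q' • contact q') q w v = _
  rw [h1.fderiv]
  simp
  ring

theorem extd_contact (q v w : J1) : extd contact q v w = v.1 * w.2.2 - w.1 * v.2.2 := by
  rw [extd, hasFDerivAt_contact.fderiv]
  simp
  ring

theorem extd_formX (q v w : J1) : extd formX q v w = 0 := by
  have : fderiv ℝ formX q = 0 := (hasFDerivAt_const (formX q) q).fderiv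
  simp [extd, this]

theorem extd_formPi (hf : DifferentiableAt ℝ f q) (hg : DifferentiableAt ℝ g q)
    (v w : J1) : extd (formPi f g) q v w =
      fderiv ℝ f q w * v.1 - fderiv ℝ f q v * w.1
        + fderiv ℝ g q v * contact q w - fderiv ℝ g q w * contact q v
        + g q * (v.1 * w.2.2 - w.1 * v.2.2) := by
  have h1 := ((hf.hasFDerivAt.smul_const (formX q)).const_sub (formP q)).fun_add
    (hg.hasFDerivAt.fun_smul (hasFDerivAt_contact (q := q)))
  rw [extd]
  -- The forms dx and dp have constant coefficients, so their base point can be frozen at q.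
  change fderiv ℝ (fun q' => formP q - f q' • formX q + g q' • contact q') q v w -
    fderiv ℝ (fun q' => formP q - f q' • formX q + g q' • contact q') q w v = _
  rw [h1.fderiv]
  simp
  ring

end ExteriorDerivatives

theorem dP_congr {g h : J1 → ℝ} {q : J1} (e : g =ᶠ[𝓝 q] h) : dP g q = dP h q := by
  simp only [dP, e.fderiv_eq]

theorem dP_const_mul {g : J1 → ℝ} {q : J1} (hg : DifferentiableAt ℝ g q) (c : ℝ) :
    dP (fun q => c * g q) q = c * dP g q := by
  simp only [dP, (hg.hasFDerivAt.const_mul c).fderiv]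
  rfl

/-- A differentiable normal connection matrix with values in `𝔞𝔰𝔩(2, ℝ)` is determined along the
section `q ↦ (q, e)`. -/
theorem normal_eq_on_section {U : Set J1} {f : J1 → ℝ} (hU : IsOpen U)
    (hf : AnalyticOnNhd ℝ f U) {ω : Matrix (Fin 3) (Fin 3) (Tot → Tot →L[ℝ] ℝ)}
    (hd : ∀ i j, ∀ q ∈ U, DifferentiableAt ℝ (sectionPull ω i j) q)
    (hasl : ∀ q ∈ U, ∀ v, matEval ω (unitSection q) v ∈ asl) (hn : IsNormal U f ω)
    {q : J1} (hq : q ∈ U) (v : J1) :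
    matEval ω (unitSection q) (v, 0) = matEval (cartanForm f) (unitSection q) (v, 0) := by
  set η := sectionPull ω with hη
  obtain ⟨e1, e2, ⟨μ₀, e21⟩, t1, t2, ⟨r1, c11⟩, ⟨r2, c21⟩⟩ := hn
  rw [← hη] at e1 e2 e21 t1 t2 c11 c21
  have z00 : ∀ q ∈ U, ∀ v, η 0 0 q v = 0 := fun q hq v => (hasl q hq (v, 0)).1
  have z01 : ∀ q ∈ U, ∀ v, η 0 1 q v = 0 := fun q hq v => (hasl q hq (v, 0)).2.1
  have z02 : ∀ q ∈ U, ∀ v, η 0 2 q v = 0 := fun q hq v => (hasl q hq (v, 0)).2.2.1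
  have tr : ∀ q ∈ U, ∀ v, η 2 2 q v = -η 1 1 q v := fun q hq v =>
    eq_neg_of_add_eq_zero_right (hasl q hq (v, 0)).2.2.2
  -- Coefficients obtained by evaluating η on ∂_y inherit differentiability from η, whereas the
  -- function μ₀ supplied by normality comes with no regularity.
  let μ : J1 → ℝ := fun q => η 2 1 q (0, 1, 0)
  let a : J1 → ℝ := fun q => η 1 1 q (0, 1, 0)
  let β : J1 → ℝ := fun q => η 1 2 q (0, 1, 0)
  have hμ : ∀ q ∈ U, η 2 1 q = formPi f μ q := by
    intro q hq
    have : μ q = μ₀ q := by simp [μ, e21 q hq]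
    rw [e21 q hq]
    simp only [formPi, this]
  have dμ : ∀ q ∈ U, DifferentiableAt ℝ μ q := fun q hq =>
    (hd 2 1 q hq).clm_apply (differentiableAt_const _)
  have da : ∀ q ∈ U, DifferentiableAt ℝ a q := fun q hq =>
    (hd 1 1 q hq).clm_apply (differentiableAt_const _)
  -- The frame ∂_x + p ∂_y, ∂_y, ∂_p, dual to dx, dy - p dx, dp.
  have dec : ∀ q v : J1, v = v.1 • ((1, q.2.2, 0) : J1) + contact q v • ((0, 1, 0) : J1)
      + v.2.2 • ((0, 0, 1) : J1) := by
    intro q v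
    ext <;> simp
    ring
  have ev : ∀ {s : Set J1} {q : J1} {α α' : J1 → J1 →L[ℝ] ℝ}, IsOpen s → q ∈ s →
      (∀ q ∈ s, α q = α' q) → α =ᶠ[𝓝 q] α' := fun hs hq h =>
    Filter.eventually_of_mem (hs.mem_nhds hq) h
  -- Θ² = dω¹ + η²₁ ∧ dx - η¹₁ ∧ ω¹, where ω¹ = dy - p dx and dω¹ = dx ∧ dp.
  have T2 : ∀ q ∈ U, ∀ v w : J1, (v.1 * w.2.2 - w.1 * v.2.2)
      + (η 2 1 q v * w.1 - η 2 1 q w * v.1) - (η 1 1 q v * contact q w - η 1 1 q w * contact q v)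
      = 0 := by
    intro q hq v w
    have := t2 q hq v w
    simp only [curvature, Fin.sum_univ_three, wedge] at this
    rw [extd_congr (ev hU hq e2), extd_contact, z00 q hq, z00 q hq, tr q hq, tr q hq, e1 q hq,
      e2 q hq] at this
    simp only [formX_apply] at this
    linarith
  have T1 : ∀ q ∈ U, ∀ v w : J1, (η 1 1 q v * w.1 - η 1 1 q w * v.1)
      + (η 1 2 q v * contact q w - η 1 2 q w * contact q v) = 0 := by
    intro q hq v w
    have := t1 q hq v w
    simp only [curvature, Fin.sum_univ_three, wedge] at this
    rw [extd_congr (ev hU hq e1), extd_formX, z00 q hq, z00 q hq, e1 q hq, e2 q hq] at this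
    simp only [formX_apply] at this
    linarith
  -- Θ² = 0 on (∂_x + p ∂_y, ∂_y) fixes the dx-coefficient of η¹₁; on (∂_y, ∂_p) it kills the
  -- dp-coefficient.
  have hα : ∀ q ∈ U, η 1 1 q = -μ q • formX q + a q • contact q := by
    intro q hq
    have k1 := T2 q hq (1, q.2.2, 0) (0, 1, 0)
    have k2 := T2 q hq (0, 1, 0) (0, 0, 1)
    simp at k1 k2
    refine ContinuousLinearMap.ext fun v => ?_
    conv_lhs => rw [dec q v]
    simp only [map_add, map_smul, k2, smul_eq_mul]
    have : η 1 1 q (1, q.2.2, 0) = -μ q := by simp only [μ]; linarith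
    rw [this]
    simp [a]
    ring
  -- The symmetry in Cartan's lemma: η¹₁ ∧ dx + η¹₂ ∧ ω¹ = 0 makes the dx-coefficient of η¹₂ equal
  -- to the ω¹-coefficient a of η¹₁.
  have hβ : ∀ q ∈ U, ∀ v, η 1 2 q v = a q * v.1 + β q * contact q v := by
    intro q hq v
    have k1 := T1 q hq (1, q.2.2, 0) (0, 1, 0)
    have k2 := T1 q hq (0, 1, 0) (0, 0, 1)
    simp at k1 k2
    conv_lhs => rw [dec q v]
    simp only [map_add, map_smul, k2, smul_eq_mul]
    have : η 1 2 q (1, q.2.2, 0) = a q := by simp only [a]; linarith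
    rw [this]
    simp [β]
    ring
  have C21 : ∀ q ∈ U, ∀ v w : J1, extd (formPi f μ) q v w
      + 2 * (formPi f μ q v * η 1 1 q w - formPi f μ q w * η 1 1 q v)
      = r2 q * (v.1 * contact q w - w.1 * contact q v) := by
    intro q hq v w
    have := c21 q hq v w
    simp only [curvature, Fin.sum_univ_three, wedge] at this
    rw [extd_congr (ev hU hq hμ), z01 q hq, z01 q hq, tr q hq, tr q hq, hμ q hq] at this
    simp only [formX_apply] at this
    linarith
  have C11 : ∀ q ∈ U, ∀ v w : J1, extd (fun q => -μ q • formX q + a q • contact q) q v w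
      + (η 1 2 q v * formPi f μ q w - η 1 2 q w * formPi f μ q v)
      = r1 q * (v.1 * contact q w - w.1 * contact q v) := by
    intro q hq v w
    have := c11 q hq v w
    simp only [curvature, Fin.sum_univ_three, wedge] at this
    rw [extd_congr (ev hU hq hα), z01 q hq, z01 q hq, hμ q hq] at this
    simp only [formX_apply] at this
    linarith
  -- The dx ∧ dp-coefficient of Θ²₁ = dΠ + 2 Π ∧ η¹₁ is f_p + 3μ. The result is needed on all of U
  -- because it is differentiated next.
  have vμ : ∀ q ∈ U, μ q = -(1 / 3) * dP f q := by
    intro q hq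
    have k := C21 q hq (1, q.2.2, 0) (0, 0, 1)
    rw [extd_formPi (hf q hq).differentiableAt (dμ q hq), hα q hq] at k
    simp at k
    have : fderiv ℝ f q (0, 0, 1) = dP f q := rfl
    linarith
  -- The ω¹ ∧ dp-coefficient of Θ²₁ is -μ_p - 2a.
  have va : ∀ q ∈ U, a q = 1 / 6 * dP (dP f) q := by
    intro q hq
    have k := C21 q hq (0, 1, 0) (0, 0, 1)
    rw [extd_formPi (hf q hq).differentiableAt (dμ q hq), hα q hq] at k
    simp at k
    have h1 : fderiv ℝ μ q (0, 0, 1) = -(1 / 3) * dP (dP f) q :=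
      (dP_congr (Filter.eventually_of_mem (hU.mem_nhds hq) vμ)).trans
        (dP_const_mul (analyticOnNhd_dP hf q hq).differentiableAt _)
    linarith
  -- The ω¹ ∧ dp-coefficient of Θ¹₁ is β - a_p.
  have vβ : β q = 1 / 6 * dP (dP (dP f)) q := by
    have k := C11 q hq (0, 1, 0) (0, 0, 1)
    rw [extd_formX_contact (g := fun q => -μ q) (dμ q hq).neg (da q hq), hβ q hq, hβ q hq] at k
    simp at k
    have h1 : fderiv ℝ a q (0, 0, 1) = 1 / 6 * dP (dP (dP f)) q :=
      (dP_congr (Filter.eventually_of_mem (hU.mem_nhds hq) va)).trans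
        (dP_const_mul (analyticOnNhd_dP (analyticOnNhd_dP hf) q hq).differentiableAt _)
    linarith
  rw [matEval_cartanForm, theta1_unitSection, theta2_unitSection, theta3_unitSection,
    Omega1_unitSection, Omega2_unitSection]
  have w11 : η 1 1 q v = 1 / 3 * dP f q * v.1 + 1 / 6 * dP (dP f) q * contact q v := by
    rw [hα q hq, vμ q hq, va q hq]
    simp
  ext i j
  rw [← sectionPull_apply, ← hη]
  fin_cases i <;> fin_cases j
  · exact z00 q hq v
  · exact z01 q hq v
  · exact z02 q hq v
  · exact congrArg (· v) (e1 q hq)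
  · exact w11
  · refine (hβ q hq v).trans ?_
    rw [va q hq, vβ]
    simp
    ring
  · exact congrArg (· v) (e2 q hq)
  · refine (congrArg (· v) (hμ q hq)).trans ?_
    simp only [formPi_apply, vμ q hq]
    rfl
  · refine (tr q hq v).trans ?_
    rw [w11]
    simp

/-- An equivariant matrix of 1-forms that reproduces the fundamental vector fields is determined
by its values along the section `q ↦ (q, e)`. -/
theorem eq_of_eq_on_section {U : Set J1} {ω ω' : Matrix (Fin 3) (Fin 3) (Tot → Tot →L[ℝ] ℝ)}
    (he : ∀ T ∈ H, ∀ b ∈ bundle U, ∀ v, matEval ω (act T b) (fderiv ℝ (act T) b v) =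
      ((T⁻¹ : Matrix.SpecialLinearGroup (Fin 3) ℝ) : Mat3) * matEval ω b v * (T : Mat3))
    (he' : ∀ T ∈ H, ∀ b ∈ bundle U, ∀ v, matEval ω' (act T b) (fderiv ℝ (act T) b v) =
      ((T⁻¹ : Matrix.SpecialLinearGroup (Fin 3) ℝ) : Mat3) * matEval ω' b v * (T : Mat3))
    (hρ : ∀ b ∈ bundle U, ∀ X ∈ hLie, matEval ω b (fundVec X b) = X)
    (hρ' : ∀ b ∈ bundle U, ∀ X ∈ hLie, matEval ω' b (fundVec X b) = X)
    (hs : ∀ q ∈ U, ∀ v, matEval ω (unitSection q) (v, 0) = matEval ω' (unitSection q) (v, 0))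
    {b : Tot} (hb : b ∈ bundle U) (v : Tot) : matEval ω b v = matEval ω' b v := by
  have hq := unitSection_mem hb.1
  have hs' : ∀ v, matEval ω (unitSection b.1) v = matEval ω' (unitSection b.1) v := by
    intro v
    -- The element of 𝔥 whose fundamental vector at (q, e) is the vertical part of v.
    let X : Mat3 := !![0, 0, 0; 0, v.2.1, -v.2.2; 0, 0, -v.2.1]
    have hX : X ∈ hLie := ⟨⟨by simp [X], by simp [X], by simp [X], by simp [X]⟩, by simp [X],
      by simp [X], by simp [X]⟩
    have hv : v = (v.1, 0) + fundVec X (unitSection b.1) := by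
      rw [fundVec_eq]
      ext <;> simp [X, unitSection]
    rw [hv, matEval_add, matEval_add, hs _ hb.1, hρ _ hq X hX, hρ' _ hq X hX]
  have hne := hb.2
  have hT := hElt_mem b.2.1 b.2.2 hne
  have hbT : act (hElt b.2.1 b.2.2 hne : Mat3) (unitSection b.1) = b := by
    rw [coe_hElt, act_hMat]
    simp [unitSection]
  -- The action of T is linear in b, hence equal to its own differential; the vector on the left is
  -- the preimage of v under it.
  have hv : act (hElt b.2.1 b.2.2 hne : Mat3)
      (v.1, v.2.1 / b.2.1, b.2.1 * (v.2.2 - v.2.1 * b.2.2 / b.2.1)) = v := by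
    rw [coe_hElt, act_hMat]
    ext <;> simp <;> field_simp
    ring
  have k := he _ hT _ hq (v.1, v.2.1 / b.2.1, b.2.1 * (v.2.2 - v.2.1 * b.2.2 / b.2.1))
  have k' := he' _ hT _ hq (v.1, v.2.1 / b.2.1, b.2.1 * (v.2.2 - v.2.1 * b.2.2 / b.2.1))
  rw [fderiv_act, hbT, hv] at k k'
  rw [k, k', hs']

/-- The uniqueness of the normal connection, for connection matrices that need not be
isomorphisms onto `𝔞𝔰𝔩(2, ℝ)`. -/
theorem normal_unique {U : Set J1} {f : J1 → ℝ} (hU : IsOpen U) (hf : AnalyticOnNhd ℝ f U)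
    {ω : Matrix (Fin 3) (Fin 3) (Tot → Tot →L[ℝ] ℝ)}
    (hd : ∀ i j, ∀ b ∈ bundle U, DifferentiableAt ℝ (ω i j) b)
    (hasl : ∀ b ∈ bundle U, ∀ v, matEval ω b v ∈ asl)
    (he : ∀ T ∈ H, ∀ b ∈ bundle U, ∀ v, matEval ω (act T b) (fderiv ℝ (act T) b v) =
      ((T⁻¹ : Matrix.SpecialLinearGroup (Fin 3) ℝ) : Mat3) * matEval ω b v * (T : Mat3))
    (hρ : ∀ b ∈ bundle U, ∀ X ∈ hLie, matEval ω b (fundVec X b) = X)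
    (hn : IsNormal U f ω) {b : Tot} (hb : b ∈ bundle U) (v : Tot) :
    matEval ω b v = matEval (cartanForm f) b v := by
  have hcc := isCartanConnection hf
  refine eq_of_eq_on_section he hcc.equivariant hρ hcc.fundamental (fun q hq w => ?_) hb v
  refine normal_eq_on_section hU hf (fun i j q hq => ?_)
    (fun q hq => hasl _ (unitSection_mem hq)) hn hq w
  exact ((hd i j _ (unitSection_mem hq)).comp q
    (hasFDerivAt_unitSection q).differentiableAt).clm_comp (differentiableAt_const _)

/-! ### From isomorphisms to equivalences -/

section Components

variable {E G : Type*} [NormedAddCommGroup E] [NormedSpace ℝ E] [NormedAddCommGroup G]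
  [NormedSpace ℝ G] {γ : ℝ → E × G} {v : E × G} {x : ℝ}

theorem hasDerivAt_fst_comp (h : HasDerivAt γ v x) : HasDerivAt (fun x => (γ x).1) v.1 x :=
  (ContinuousLinearMap.fst ℝ E G).hasFDerivAt.comp_hasDerivAt x h

theorem hasDerivAt_snd_comp (h : HasDerivAt γ v x) : HasDerivAt (fun x => (γ x).2) v.2 x :=
  (ContinuousLinearMap.snd ℝ E G).hasFDerivAt.comp_hasDerivAt x h

end Components

/-- The map of the bases that is covered by a bundle map `F`. -/
def baseMap (F : Tot → Tot) (q : J1) : J1 := (F (unitSection q)).1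

section Iso

variable {V V' : Set J1} {f f' : J1 → ℝ} {F : Tot → Tot}

theorem fst_eq_baseMap (hF : IsCartanIso V f V' f' F) {b : Tot} (hb : b ∈ bundle V) :
    (F b).1 = baseMap F b.1 := by
  obtain ⟨T, hT, h⟩ := exists_act_eq (unitSection_mem hb.1) hb rfl
  rw [← h, hF.equivariant T hT _ (unitSection_mem hb.1)]
  rfl

/-- Image points over the same base point differ by some T ∈ H. Equivariance moves T to the source,
where injectivity of F applies. -/
theorem baseMap_injOn (hF : IsCartanIso V f V' f' F) : InjOn (baseMap F) V := by
  intro q₁ h₁ q₂ h₂ h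
  have m₁ := hF.bijOn.mapsTo (unitSection_mem h₁)
  have m₂ := hF.bijOn.mapsTo (unitSection_mem h₂)
  obtain ⟨T, hT, e⟩ := exists_act_eq m₁ m₂ h
  rw [← hF.equivariant T hT _ (unitSection_mem h₁)] at e
  exact congrArg Prod.fst
    (hF.bijOn.injOn (act_mem_bundle hT (unitSection_mem h₁)) (unitSection_mem h₂) e)

theorem baseMap_bijOn (hF : IsCartanIso V f V' f' F) : BijOn (baseMap F) V V' := by
  refine ⟨fun q hq => (hF.bijOn.mapsTo (unitSection_mem hq)).1, baseMap_injOn hF, ?_⟩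
  intro q' hq'
  obtain ⟨b, hb, e⟩ := hF.bijOn.surjOn (unitSection_mem hq')
  exact ⟨b.1, hb.1, by rw [← fst_eq_baseMap hF hb, e]; rfl⟩

theorem baseMap_analyticAt (hF : IsCartanIso V f V' f' F) {q : J1} (hq : q ∈ V) :
    AnalyticAt ℝ (baseMap F) q := by
  have h1 : AnalyticAt ℝ unitSection q := analyticAt_id.prod analyticAt_const
  exact analyticAt_fst.fun_comp ((hF.analytic _ (unitSection_mem hq)).fun_comp h1)

theorem fderiv_baseMap (hF : IsCartanIso V f V' f' F) {q : J1} (hq : q ∈ V) (w : J1) :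
    fderiv ℝ (baseMap F) q w = (fderiv ℝ F (unitSection q) (w, 0)).1 := by
  have h1 := (hF.analytic _ (unitSection_mem hq)).differentiableAt.hasFDerivAt
  have h2 : HasFDerivAt (baseMap F) _ q := (h1.comp q (hasFDerivAt_unitSection q)).fst
  rw [h2.fderiv]
  rfl

theorem fibreScale_ne_zero (hF : IsCartanIso V f V' f' F) {q : J1} (hq : q ∈ V) :
    (F (unitSection q)).2.1 ≠ 0 :=
  (hF.bijOn.mapsTo (unitSection_mem hq)).2

/-- The pull-backs of `dx`, `dy - p dx` and `dp - f dx - (1/3) f_p (dy - p dx)` by the base map of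
an isomorphism. -/
theorem baseMap_pullback (hF : IsCartanIso V f V' f' F) {q : J1} (hq : q ∈ V) (w : J1) :
    (fderiv ℝ (baseMap F) q w).1 =
        (F (unitSection q)).2.1 * w.1 - (F (unitSection q)).2.2 * contact q w ∧
      contact (baseMap F q) (fderiv ℝ (baseMap F) q w) =
        contact q w / (F (unitSection q)).2.1 ∧
      formPi f' (fun q => -(1 / 3) * dP f' q) (baseMap F q) (fderiv ℝ (baseMap F) q w) =
        formPi f (fun q => -(1 / 3) * dP f q) q w / (F (unitSection q)).2.1 ^ 2 := by
  have h := hF.pullback _ (unitSection_mem hq) (w, 0)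
  have ha := fibreScale_ne_zero hF hq
  rw [matEval_cartanForm, matEval_cartanForm, theta1_unitSection, theta2_unitSection,
    theta3_unitSection] at h
  have e := fun i j => congrFun (congrFun h i) j
  have e1 := e 2 0
  have e2 := e 2 1
  have e3 := e 1 0
  simp only [Matrix.of_apply, Matrix.cons_val] at e1 e2 e3
  rw [theta1_apply, ← fderiv_baseMap hF hq] at e1
  rw [theta2_apply, ← fderiv_baseMap hF hq] at e2
  rw [theta3_apply, ← fderiv_baseMap hF hq] at e3
  change _ * contact (baseMap F q) _ = _ at e1
  change _ * formPi f' (fun q => -(1 / 3) * dP f' q) (baseMap F q) _ = _ at e2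
  change _ * contact (baseMap F q) _ + _ = w.1 at e3
  have k1 : contact (baseMap F q) (fderiv ℝ (baseMap F) q w) =
      contact q w / (F (unitSection q)).2.1 := by
    rw [← e1]
    field_simp
  refine ⟨?_, k1, ?_⟩
  · rw [k1] at e3
    rw [← e3]
    field_simp
    ring
  · rw [← e2]
    field_simp

/-- The three pulled-back forms are linearly independent, so the derivative is injective, hence
surjective by dimension, and the map is open at q. -/
theorem baseMap_nhds (hF : IsCartanIso V f V' f' F) {q : J1} (hq : q ∈ V) :
    Filter.map (baseMap F) (𝓝 q) = 𝓝 (baseMap F q) := by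
  refine (baseMap_analyticAt hF hq).hasStrictFDerivAt.map_nhds_eq_of_surj ?_
  rw [LinearMap.range_eq_top]
  apply LinearMap.injective_iff_surjective.1
  rw [injective_iff_map_eq_zero]
  intro w hw
  have ha := fibreScale_ne_zero hF hq
  obtain ⟨h1, h2, h3⟩ := baseMap_pullback hF hq w
  have hw' : fderiv ℝ (baseMap F) q w = 0 := hw
  rw [hw', map_zero] at h2 h3
  have hc : contact q w = 0 := by simpa [ha] using h2.symm
  rw [hw', hc] at h1
  have hx : w.1 = 0 := by simpa [ha] using h1.symm
  have hy : w.2.1 = 0 := by simpa [hx] using hc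
  have hp : formPi f (fun q => -(1 / 3) * dP f q) q w = 0 := by
    rcases div_eq_zero_iff.1 h3.symm with h | h
    · exact h
    · exact absurd h (pow_ne_zero 2 ha)
  have hp' : w.2.2 = 0 := by simpa [hx, hy] using hp
  ext <;> simp [hx, hy, hp']

/-- Restriction of an isomorphism to a smaller base. -/
theorem isCartanIso_restrict (hF : IsCartanIso V f V' f' F) {W : Set J1} (hW : W ⊆ V) :
    IsCartanIso W f (baseMap F '' W) f' F := by
  have hsub : bundle W ⊆ bundle V := fun b hb => ⟨hW hb.1, hb.2⟩
  refine ⟨fun b hb => hF.analytic b (hsub hb), ⟨?_, hF.bijOn.injOn.mono hsub, ?_⟩,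
    fun T hT b hb => hF.equivariant T hT b (hsub hb), fun b hb => hF.pullback b (hsub hb)⟩
  · intro b hb
    refine ⟨⟨b.1, hb.1, (fst_eq_baseMap hF (hsub hb)).symm⟩, (hF.bijOn.mapsTo (hsub hb)).2⟩
  · rintro b' ⟨⟨q, hq, hqb⟩, hb'⟩
    have : b' ∈ bundle V' := ⟨hqb ▸ (baseMap_bijOn hF).mapsTo (hW hq), hb'⟩
    obtain ⟨b, hb, rfl⟩ := hF.bijOn.surjOn this
    rw [fst_eq_baseMap hF hb] at hqb
    have := baseMap_injOn hF (hW hq) hb.1 hqb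
    exact ⟨b, ⟨this ▸ hq, hb.2⟩, rfl⟩

theorem isOpen_image_baseMap (hF : IsCartanIso V f V' f' F) {W : Set J1} (hW : W ⊆ V)
    (hWo : IsOpen W) : IsOpen (baseMap F '' W) := by
  rw [isOpen_iff_mem_nhds]
  rintro _ ⟨q, hq, rfl⟩
  rw [← baseMap_nhds hF (hW hq)]
  exact Filter.image_mem_map (hWo.mem_nhds hq)

/-- The base map carries jets of solutions to curves that satisfy the other equation. -/
theorem hasDerivAt_baseMap_jet1 (hF : IsCartanIso V f V' f' F) {I : Set ℝ} {y : ℝ → ℝ}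
    (hy : IsSolution V f I y) {x : ℝ} (hx : x ∈ I) :
    HasDerivAt (fun x => baseMap F (jet1 y x))
      ((F (unitSection (jet1 y x))).2.1 •
        ((1, (baseMap F (jet1 y x)).2.2, f' (baseMap F (jet1 y x))) : J1)) x := by
  have hq := hy.jet_mem x hx
  have hj : HasDerivAt (jet1 y) (1, deriv y x, f (jet1 y x)) x :=
    (hasDerivAt_id x).prodMk ((hy.differentiableAt x hx).hasDerivAt.prodMk (hy.eqn x hx))
  refine ((baseMap_analyticAt hF hq).differentiableAt.hasFDerivAt.comp_hasDerivAt x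
    hj).congr_deriv ?_
  obtain ⟨h1, h2, h3⟩ := baseMap_pullback hF hq (1, deriv y x, f (jet1 y x))
  have hc : contact (jet1 y x) (1, deriv y x, f (jet1 y x)) = 0 := by simp [jet1]
  have hp : formPi f (fun q => -(1 / 3) * dP f q) (jet1 y x) (1, deriv y x, f (jet1 y x)) = 0 := by
    simp [jet1]
  rw [hc] at h1 h2
  rw [hp] at h3
  simp only [zero_div, contact_apply, mul_zero, sub_zero, mul_one, formPi_apply] at h1 h2 h3
  rw [h2] at h3
  rw [h1] at h2 h3
  ext
  · simpa using h1
  · simp only [Prod.smul_snd, Prod.smul_fst, smul_eq_mul]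
    linarith
  · simp only [Prod.smul_snd, smul_eq_mul]
    linarith

/-- The first two components of the base map do not depend on `p`. -/
theorem baseMap_toJ0 (hF : IsCartanIso V f V' f' F) (hV : IsOpen V)
    (hconn : ∀ x y : ℝ, IsPreconnected {p : ℝ | (x, y, p) ∈ V}) {x y p p' : ℝ}
    (h : (x, y, p) ∈ V) (h' : (x, y, p') ∈ V) :
    toJ0 (baseMap F (x, y, p)) = toJ0 (baseMap F (x, y, p')) := by
  have hd : ∀ p ∈ {p : ℝ | (x, y, p) ∈ V},
      HasDerivAt (fun p => toJ0 (baseMap F (x, y, p))) 0 p := by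
    intro p hp
    have hl : HasDerivAt (fun p : ℝ => ((x, y, p) : J1)) (0, 0, 1) p :=
      (hasDerivAt_const p x).prodMk ((hasDerivAt_const p y).prodMk (hasDerivAt_id p))
    have hb := (baseMap_analyticAt hF hp).differentiableAt.hasFDerivAt.comp_hasDerivAt p hl
    -- Both dx and dy - p dx vanish on ∂_p, hence so do the differentials of x̄ and ȳ.
    obtain ⟨h1, h2, -⟩ := baseMap_pullback hF hp (0, 0, 1)
    simp at h1 h2
    rw [h1] at h2
    refine ((hasDerivAt_fst_comp hb).prodMk
      (hasDerivAt_fst_comp (hasDerivAt_snd_comp hb))).congr_deriv ?_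
    ext
    · exact h1
    · simpa using h2
  exact IsOpen.is_const_of_deriv_eq_zero (hV.preimage (by fun_prop)) (hconn x y)
    (fun p hp => (hd p hp).differentiableAt.differentiableWithinAt)
    (fun p hp => (hd p hp).deriv) h h'

theorem exists_pointMap (hF : IsCartanIso V f V' f' F) (hV : IsOpen V)
    (hconn : ∀ x y : ℝ, IsPreconnected {p : ℝ | (x, y, p) ∈ V}) :
    ∃ Φ : J0 → J0, ∀ q ∈ V, Φ (toJ0 q) = toJ0 (baseMap F q) := by
  classical
  -- The chosen p is irrelevant by `baseMap_toJ0`; off the projection of V the value 0 is arbitrary.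
  refine ⟨fun z => if h : ∃ p, (z.1, z.2, p) ∈ V then
    toJ0 (baseMap F (z.1, z.2, h.choose)) else 0, ?_⟩
  intro q hq
  have hex : ∃ p, ((toJ0 q).1, (toJ0 q).2, p) ∈ V := ⟨q.2.2, hq⟩
  simp only [hex, dite_true]
  exact baseMap_toJ0 hF hV hconn hex.choose_spec hq

/-- Near a point p can be frozen, so Φ inherits analyticity and derivatives from the base map
although it is defined by choice. -/
theorem pointMap_eventuallyEq (hV : IsOpen V) {Φ : J0 → J0}
    (hΦ : ∀ q ∈ V, Φ (toJ0 q) = toJ0 (baseMap F q)) {q : J1} (hq : q ∈ V) :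
    Φ =ᶠ[𝓝 (toJ0 q)] fun z => toJ0 (baseMap F (z.1, z.2, q.2.2)) := by
  have hc : ContinuousAt (fun z : J0 => ((z.1, z.2, q.2.2) : J1)) (toJ0 q) := by fun_prop
  have hm : V ∈ 𝓝 ((fun z : J0 => ((z.1, z.2, q.2.2) : J1)) (toJ0 q)) := hV.mem_nhds hq
  filter_upwards [hc.preimage_mem_nhds hm] with z hz
  exact hΦ _ hz

theorem fderiv_pointMap (hF : IsCartanIso V f V' f' F) (hV : IsOpen V) {Φ : J0 → J0}
    (hΦ : ∀ q ∈ V, Φ (toJ0 q) = toJ0 (baseMap F q)) {q : J1} (hq : q ∈ V) (w : J0) :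
    fderiv ℝ Φ (toJ0 q) w = toJ0 (fderiv ℝ (baseMap F) q (w.1, w.2, 0)) := by
  rw [(pointMap_eventuallyEq hV hΦ hq).fderiv_eq]
  have hl : HasFDerivAt (fun z : J0 => ((z.1, z.2, q.2.2) : J1))
      ((ContinuousLinearMap.fst ℝ ℝ ℝ).prod ((ContinuousLinearMap.snd ℝ ℝ ℝ).prod 0)) (toJ0 q) :=
    hasFDerivAt_fst.prodMk (hasFDerivAt_snd.prodMk (hasFDerivAt_const _ _))
  have hb := HasFDerivAt.comp (toJ0 q) (g := baseMap F)
    ((baseMap_analyticAt hF hq).differentiableAt.hasFDerivAt) hl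
  have := hb.fst.prodMk hb.snd.fst
  change fderiv ℝ (fun z : J0 => ((baseMap F (z.1, z.2, q.2.2)).1,
    (baseMap F (z.1, z.2, q.2.2)).2.1)) (toJ0 q) w = _
  erw [this.fderiv]
  rfl

/-- Evaluate the pull-back of dx on ∂_x + p ∂_y, where the contact form vanishes. -/
theorem prolongDen_pointMap (hF : IsCartanIso V f V' f' F) (hV : IsOpen V) {Φ : J0 → J0}
    (hΦ : ∀ q ∈ V, Φ (toJ0 q) = toJ0 (baseMap F q)) {q : J1} (hq : q ∈ V) :
    prolongDen Φ q = (F (unitSection q)).2.1 := by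
  rw [prolongDen, fderiv_pointMap hF hV hΦ hq]
  refine (baseMap_pullback hF hq (1, q.2.2, 0)).1.trans ?_
  simp

/-- The image of ∂_x + p ∂_y is again annihilated by the contact form, so its slope is the
p-coordinate of the image point. -/
theorem prolong_pointMap (hF : IsCartanIso V f V' f' F) (hV : IsOpen V) {Φ : J0 → J0}
    (hΦ : ∀ q ∈ V, Φ (toJ0 q) = toJ0 (baseMap F q)) {q : J1} (hq : q ∈ V) :
    prolong Φ q = baseMap F q := by
  have ha := fibreScale_ne_zero hF hq
  obtain ⟨h1, h2, -⟩ := baseMap_pullback hF hq (1, q.2.2, 0)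
  simp at h1 h2
  rw [prolong, prolongDen_pointMap hF hV hΦ hq, hΦ q hq, fderiv_pointMap hF hV hΦ hq]
  ext
  · rfl
  · rfl
  · simp only [toJ0]
    rw [div_eq_iff ha]
    rw [h1] at h2
    linarith

/-- A curve in `J¹` of the form `jet1`, up to a change of parameter, is the jet of a solution. -/
theorem exists_solution_of_curve {I : Set ℝ} (hI : IsOpen I) (hI' : I.OrdConnected)
    {γ : ℝ → J1} {a : ℝ → ℝ} (ha : ContinuousOn a I) (ha0 : ∀ x ∈ I, a x ≠ 0)
    (hγ : ∀ x ∈ I, HasDerivAt γ (a x • ((1, (γ x).2.2, f' (γ x)) : J1)) x)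
    (hm : ∀ x ∈ I, γ x ∈ V') :
    ∃ (I' : Set ℝ) (y' : ℝ → ℝ), IsSolution V' f' I' y' ∧
      (fun x => toJ0 (γ x)) '' I = (fun t => (t, y' t)) '' I' := by
  let t : ℝ → ℝ := fun x => (γ x).1
  have ht : ∀ x ∈ I, HasDerivAt t (a x) x := fun x hx => by
    simpa using hasDerivAt_fst_comp (hγ x hx)
  -- Rolle's theorem: the derivative a of the new parameter never vanishes.
  have hinj : InjOn t I := by
    have key : ∀ x₁ ∈ I, ∀ x₂ ∈ I, x₁ < x₂ → t x₁ ≠ t x₂ := by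
      intro x₁ h₁ x₂ h₂ hlt e
      have hsub := hI'.out h₁ h₂
      obtain ⟨c, hc, hc'⟩ := exists_deriv_eq_zero hlt
        (fun x hx => (ht x (hsub hx)).continuousAt.continuousWithinAt) e
      have hcI := hsub (Ioo_subset_Icc_self hc)
      exact ha0 c hcI ((ht c hcI).deriv.symm.trans hc')
    intro x₁ h₁ x₂ h₂ e
    rcases lt_trichotomy x₁ x₂ with h | h | h
    · exact absurd e (key _ h₁ _ h₂ h)
    · exact h
    · exact absurd e.symm (key _ h₂ _ h₁ h)
  have hmap : ∀ x ∈ I, Filter.map t (𝓝 x) = 𝓝 (t x) := by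
    intro x hx
    have hs : HasStrictDerivAt t (a x) x := hasStrictDerivAt_of_hasDerivAt_of_continuousAt
      (Filter.eventually_of_mem (hI.mem_nhds hx) ht) (ha.continuousAt (hI.mem_nhds hx))
    exact hs.map_nhds_eq (ha0 x hx)
  have hI'o : IsOpen (t '' I) := by
    rw [isOpen_iff_mem_nhds]
    rintro _ ⟨x, hx, rfl⟩
    rw [← hmap x hx]
    exact Filter.image_mem_map (hI.mem_nhds hx)
  let g : ℝ → ℝ := Function.invFunOn t I
  have hg : ∀ x ∈ I, g (t x) = x := fun x hx => hinj.leftInvOn_invFunOn hx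
  have hgd : ∀ x ∈ I, HasDerivAt g (a x)⁻¹ (t x) := by
    intro x hx
    have hc : ContinuousAt g (t x) := by
      rw [ContinuousAt, ← hmap x hx, Filter.tendsto_map'_iff, hg x hx]
      refine Filter.tendsto_id.congr' ?_
      filter_upwards [hI.mem_nhds hx] with x' hx'
      exact (hg x' hx').symm
    refine HasDerivAt.of_local_left_inverse hc (f := t) (by rw [hg x hx]; exact ht x hx)
      (ha0 x hx) ?_
    filter_upwards [hI'o.mem_nhds (mem_image_of_mem t hx)]
    rintro _ ⟨x', hx', rfl⟩
    rw [hg x' hx']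
  -- In the parameter t the curve is an integral curve of ∂_x + p ∂_y + f' ∂_p, and hence the jet of
  -- its own y-component.
  have hδ : ∀ s ∈ t '' I, HasDerivAt (fun s => γ (g s))
      ((1, (γ (g s)).2.2, f' (γ (g s))) : J1) s := by
    rintro _ ⟨x, hx, rfl⟩
    have h1 := hγ x hx
    rw [← hg x hx] at h1
    have h2 := HasDerivAt.scomp (t x) h1 (hgd x hx)
    rw [hg x hx] at h2 ⊢
    rwa [smul_smul, inv_mul_cancel₀ (ha0 x hx), one_smul] at h2
  have hd1 : ∀ s ∈ t '' I, HasDerivAt (fun s => (γ (g s)).2.1) (γ (g s)).2.2 s :=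
    fun s hs => hasDerivAt_fst_comp (hasDerivAt_snd_comp (hδ s hs))
  have hjet : ∀ s ∈ t '' I, jet1 (fun s => (γ (g s)).2.1) s = γ (g s) := by
    intro s hs
    rw [jet1, (hd1 s hs).deriv]
    obtain ⟨x, hx, rfl⟩ := hs
    rw [hg x hx]
  refine ⟨t '' I, fun s => (γ (g s)).2.1, ⟨hI'o, ?_, ?_, fun s hs => (hd1 s hs).differentiableAt,
    ?_⟩, ?_⟩
  · exact (hI'.isPreconnected.image t fun x hx =>
      (ht x hx).continuousAt.continuousWithinAt).ordConnected
  · intro s hs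
    rw [hjet s hs]
    obtain ⟨x, hx, rfl⟩ := hs
    rw [hg x hx]
    exact hm x hx
  · intro s hs
    rw [hjet s hs]
    refine (hasDerivAt_snd_comp (hasDerivAt_snd_comp (hδ s hs))).congr_of_eventuallyEq ?_
    filter_upwards [hI'o.mem_nhds hs] with s' hs'
    exact (hd1 s' hs').deriv
  · rw [image_image]
    refine image_congr fun x hx => ?_
    simp only [hg x hx]
    rfl

theorem isAreaEquiv_of_isCartanIso (hF : IsCartanIso V f V' f' F) (hV : IsOpen V)
    (hconn : ∀ x y : ℝ, IsPreconnected {p : ℝ | (x, y, p) ∈ V}) :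
    ∃ Φ, IsAreaEquiv V f V' f' Φ ∧ ∀ q ∈ V, prolong Φ q = baseMap F q := by
  obtain ⟨Φ, hΦ⟩ := exists_pointMap hF hV hconn
  refine ⟨Φ, ⟨?_, ?_, ?_, ?_, ?_⟩, fun q hq => prolong_pointMap hF hV hΦ hq⟩
  · rintro _ ⟨q, hq, rfl⟩
    refine AnalyticAt.congr ?_ (pointMap_eventuallyEq hV hΦ hq).symm
    have hl : AnalyticAt ℝ (fun z : J0 => ((z.1, z.2, q.2.2) : J1)) (toJ0 q) :=
      analyticAt_fst.prod (analyticAt_snd.prod analyticAt_const)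
    have hb : AnalyticAt ℝ (fun z : J0 => baseMap F (z.1, z.2, q.2.2)) (toJ0 q) :=
      AnalyticAt.fun_comp (g := baseMap F) (baseMap_analyticAt hF hq) hl
    exact (analyticAt_fst.fun_comp hb).prod (analyticAt_fst.fun_comp (analyticAt_snd.fun_comp hb))
  · rintro _ ⟨q, hq, rfl⟩
    have ha := fibreScale_ne_zero hF hq
    rw [jacobian, fderiv_pointMap hF hV hΦ hq, fderiv_pointMap hF hV hΦ hq]
    -- dx̄ ∧ dȳ = dx̄ ∧ (dȳ - p̄ dx̄), and the factors u₁ and 1/u₁ of the two pull-backs cancel.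
    obtain ⟨h1, h2, -⟩ := baseMap_pullback hF hq (1, 0, 0)
    obtain ⟨k1, k2, -⟩ := baseMap_pullback hF hq (0, 1, 0)
    simp only [contact_apply] at h1 h2 k1 k2
    simp only [toJ0]
    rw [sub_eq_iff_eq_add.1 h2, sub_eq_iff_eq_add.1 k2, h1, k1]
    field_simp
    ring
  · intro q hq
    rw [prolongDen_pointMap hF hV hΦ hq]
    exact fibreScale_ne_zero hF hq
  · exact (baseMap_bijOn hF).congr fun q hq => (prolong_pointMap hF hV hΦ hq).symm
  · intro I y hy
    have hjc : ContinuousOn (jet1 y) I := fun x hx =>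
      (continuousAt_id.prodMk ((hy.differentiableAt x hx).continuousAt.prodMk
        (hy.eqn x hx).continuousAt)).continuousWithinAt
    have hac : ContinuousOn (fun x => (F (unitSection (jet1 y x))).2.1) I := by
      intro x hx
      have h1 : ContinuousAt F (unitSection (jet1 y x)) :=
        (hF.analytic _ (unitSection_mem (hy.jet_mem x hx))).continuousAt
      have h2 : ContinuousAt (fun q => (F (unitSection q)).2.1) (jet1 y x) :=
        continuousAt_fst.comp' (continuousAt_snd.comp'
          (ContinuousAt.comp' h1 (contDiff_unitSection (n := 0)).continuous.continuousAt))
      exact h2.comp_continuousWithinAt (hjc x hx)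
    obtain ⟨I', y', hy', him⟩ := exists_solution_of_curve (V' := V') (f' := f') hy.isOpen
      hy.ordConnected hac (fun x hx => fibreScale_ne_zero hF (hy.jet_mem x hx))
      (fun x hx => hasDerivAt_baseMap_jet1 hF hy hx)
      (fun x hx => (baseMap_bijOn hF).mapsTo (hy.jet_mem x hx))
    refine ⟨I', y', hy', ?_⟩
    rw [← him]
    exact image_congr fun x hx => hΦ _ (hy.jet_mem x hx)

end Iso

/-- Slices of a convex set are convex. This supplies the connected fibres in the local statement. -/
theorem isPreconnected_fibre_ball (q : J1) (ε x y : ℝ) :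
    IsPreconnected {p : ℝ | (x, y, p) ∈ Metric.ball q ε} := by
  refine Convex.isPreconnected ?_
  intro p₁ h₁ p₂ h₂ s t hs ht hst
  have h := convex_ball q ε h₁ h₂ hs ht hst
  have e : s • ((x, y, p₁) : J1) + t • ((x, y, p₂) : J1) = (x, y, s • p₁ + t • p₂) := by
    ext
    · simp [← add_mul, hst]
    · simp [← add_mul, hst]
    · simp
  rw [e] at h
  exact h

/-! ### Solutions with a given jet -/

theorem exists_solution_through {V : Set J1} {f : J1 → ℝ} (hV : IsOpen V)
    (hf : AnalyticOnNhd ℝ f V) {q : J1} (hq : q ∈ V) :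
    ∃ (I : Set ℝ) (y : ℝ → ℝ), IsSolution V f I y ∧ q.1 ∈ I ∧ jet1 y q.1 = q := by
  have hX : ContDiffAt ℝ 1 (fun q : J1 => ((1, q.2.2, f q) : J1)) q :=
    contDiffAt_const.prodMk ((contDiffAt_snd.comp q contDiffAt_snd).prodMk
      (hf q hq).contDiffAt)
  obtain ⟨r, hr, ε, hε, h⟩ :=
    hX.exists_forall_mem_closedBall_exists_eq_forall_mem_Ioo_hasDerivAt q.1
  obtain ⟨α, hα0, hα⟩ := h q (Metric.mem_closedBall_self hr.le)
  have h0 : q.1 ∈ Ioo (q.1 - ε) (q.1 + ε) := ⟨by linarith, by linarith⟩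
  have hVn : α ⁻¹' V ∈ 𝓝 q.1 := (hα q.1 h0).continuousAt.preimage_mem_nhds
    (by rw [hα0]; exact hV.mem_nhds hq)
  obtain ⟨δ, hδ, hδV⟩ := Metric.mem_nhds_iff.1 (Filter.inter_mem hVn (isOpen_Ioo.mem_nhds h0))
  rw [Real.ball_eq_Ioo] at hδV
  have hI0 : q.1 ∈ Ioo (q.1 - δ) (q.1 + δ) := ⟨by linarith, by linarith⟩
  have hd : ∀ t ∈ Ioo (q.1 - δ) (q.1 + δ), HasDerivAt α (1, (α t).2.2, f (α t)) t :=
    fun t ht => hα t (hδV ht).2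
  -- The first component of the vector field is 1 and the initial time is q.1, so time is the
  -- coordinate x.
  have hx : ∀ t ∈ Ioo (q.1 - δ) (q.1 + δ), (α t).1 = t := by
    intro t ht
    have hc : ∀ t ∈ Ioo (q.1 - δ) (q.1 + δ), HasDerivAt (fun t => (α t).1 - t) 0 t :=
      fun t ht => ((hasDerivAt_fst_comp (hd t ht)).fun_sub (hasDerivAt_id' t)).congr_deriv (by simp)
    have := IsOpen.is_const_of_deriv_eq_zero isOpen_Ioo isPreconnected_Ioo
      (fun t ht => (hc t ht).differentiableAt.differentiableWithinAt)
      (fun t ht => (hc t ht).deriv) ht hI0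
    simp only [hα0, sub_self] at this
    linarith
  have hy : ∀ t ∈ Ioo (q.1 - δ) (q.1 + δ), HasDerivAt (fun t => (α t).2.1) (α t).2.2 t :=
    fun t ht => hasDerivAt_fst_comp (hasDerivAt_snd_comp (hd t ht))
  have hj : ∀ t ∈ Ioo (q.1 - δ) (q.1 + δ), jet1 (fun t => (α t).2.1) t = α t := by
    intro t ht
    rw [jet1, (hy t ht).deriv]
    ext
    · exact (hx t ht).symm
    · rfl
    · rfl
  refine ⟨Ioo (q.1 - δ) (q.1 + δ), fun t => (α t).2.1, ⟨isOpen_Ioo, ordConnected_Ioo, ?_,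
    fun t ht => (hy t ht).differentiableAt, ?_⟩, hI0, (hj _ hI0).trans hα0⟩
  · intro t ht
    rw [hj t ht]
    exact (hδV ht).1
  · intro t ht
    rw [hj t ht]
    refine (hasDerivAt_snd_comp (hasDerivAt_snd_comp (hd t ht))).congr_of_eventuallyEq ?_
    filter_upwards [isOpen_Ioo.mem_nhds ht] with t' ht'
    exact (hy t' ht').deriv

/-! ### From equivalences to isomorphisms -/

section Equiv

variable {V V' : Set J1} {f f' : J1 → ℝ} {Φ : J0 → J0}

theorem hasFDerivAt_toJ0 (q : J1) : HasFDerivAt toJ0 ((ContinuousLinearMap.fst ℝ ℝ (ℝ × ℝ)).prod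
    ((ContinuousLinearMap.fst ℝ ℝ ℝ).comp (ContinuousLinearMap.snd ℝ ℝ (ℝ × ℝ)))) q :=
  ((ContinuousLinearMap.fst ℝ ℝ (ℝ × ℝ)).prod
    ((ContinuousLinearMap.fst ℝ ℝ ℝ).comp (ContinuousLinearMap.snd ℝ ℝ (ℝ × ℝ)))).hasFDerivAt

theorem analyticAt_toJ0 (q : J1) : AnalyticAt ℝ toJ0 q :=
  ((ContinuousLinearMap.fst ℝ ℝ (ℝ × ℝ)).prod
    ((ContinuousLinearMap.fst ℝ ℝ ℝ).comp (ContinuousLinearMap.snd ℝ ℝ (ℝ × ℝ)))).analyticAt q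

theorem fderiv_J0_eq (Φ : J0 → J0) (z : J0) (s t : ℝ) :
    fderiv ℝ Φ z (s, t) = s • fderiv ℝ Φ z (1, 0) + t • fderiv ℝ Φ z (0, 1) := by
  rw [← map_smul, ← map_smul, ← map_add]
  simp

theorem analyticAt_fderiv_comp_toJ0 (h : IsAreaEquiv V f V' f' Φ) {q : J1} (hq : q ∈ V)
    (z : J0) : AnalyticAt ℝ (fun q : J1 => fderiv ℝ Φ (toJ0 q) z) q :=
  ((ContinuousLinearMap.apply ℝ J0 z).analyticAt _).fun_comp
    (AnalyticAt.fun_comp (g := fderiv ℝ Φ) (h.analytic.fderiv _ (mem_image_of_mem toJ0 hq))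
      (analyticAt_toJ0 q))

theorem analyticAt_totalDerivative (h : IsAreaEquiv V f V' f' Φ) {q : J1} (hq : q ∈ V) :
    AnalyticAt ℝ (fun q : J1 => fderiv ℝ Φ (toJ0 q) (1, q.2.2)) q := by
  have hp : AnalyticAt ℝ (fun q : J1 => q.2.2) q := analyticAt_snd.fun_comp analyticAt_snd
  have := (analyticAt_fderiv_comp_toJ0 h hq (1, 0)).fun_add
    (hp.fun_smul (analyticAt_fderiv_comp_toJ0 h hq (0, 1)))
  refine this.congr (Filter.Eventually.of_forall fun q => ?_)
  dsimp only
  rw [fderiv_J0_eq Φ _ 1 q.2.2, one_smul]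

theorem analyticAt_prolongDen (h : IsAreaEquiv V f V' f' Φ) {q : J1} (hq : q ∈ V) :
    AnalyticAt ℝ (prolongDen Φ) q :=
  analyticAt_fst.fun_comp (analyticAt_totalDerivative h hq)

theorem analyticAt_prolong (h : IsAreaEquiv V f V' f' Φ) {q : J1} (hq : q ∈ V) :
    AnalyticAt ℝ (prolong Φ) q := by
  have h0 : AnalyticAt ℝ (fun q : J1 => Φ (toJ0 q)) q :=
    AnalyticAt.fun_comp (g := Φ) (h.analytic _ (mem_image_of_mem toJ0 hq)) (analyticAt_toJ0 q)
  exact (analyticAt_fst.fun_comp h0).prod ((analyticAt_snd.fun_comp h0).prod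
    ((analyticAt_snd.fun_comp (analyticAt_totalDerivative h hq)).fun_div
      (analyticAt_prolongDen h hq) (h.prolongDen_ne_zero q hq)))

theorem hasFDerivAt_prolong (h : IsAreaEquiv V f V' f' Φ) {q : J1} (hq : q ∈ V) :
    HasFDerivAt (prolong Φ) (fderiv ℝ (prolong Φ) q) q :=
  (analyticAt_prolong h hq).differentiableAt.hasFDerivAt

theorem hasFDerivAt_pointMap (h : IsAreaEquiv V f V' f' Φ) {q : J1} (hq : q ∈ V) :
    HasFDerivAt Φ (fderiv ℝ Φ (toJ0 q)) (toJ0 q) :=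
  (h.analytic _ (mem_image_of_mem toJ0 hq)).differentiableAt.hasFDerivAt

/-- The chain rule for toJ0 ∘ prolong Φ = Φ ∘ toJ0. -/
theorem toJ0_fderiv_prolong (h : IsAreaEquiv V f V' f' Φ) {q : J1} (hq : q ∈ V) (w : J1) :
    toJ0 (fderiv ℝ (prolong Φ) q w) = fderiv ℝ Φ (toJ0 q) (toJ0 w) := by
  have h1 := (hasFDerivAt_toJ0 (prolong Φ q)).comp q (hasFDerivAt_prolong h hq)
  have h2 := (hasFDerivAt_pointMap h hq).comp q (hasFDerivAt_toJ0 q)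
  exact congrArg (· w) (h1.unique h2)

/-- The derivative of the slope of the prolonged map along the fibre. -/
theorem fderiv_prolong_vertical (h : IsAreaEquiv V f V' f' Φ) {q : J1} (hq : q ∈ V) :
    (fderiv ℝ (prolong Φ) q (0, 0, 1)).2.2 = 1 / prolongDen Φ q ^ 2 := by
  have hl : HasDerivAt (fun p : ℝ => ((q.1, q.2.1, p) : J1)) (0, 0, 1) q.2.2 :=
    (hasDerivAt_const _ _).prodMk ((hasDerivAt_const _ _).prodMk (hasDerivAt_id _))
  have h1 := hasDerivAt_snd_comp (hasDerivAt_snd_comp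
    (HasFDerivAt.comp_hasDerivAt (f := fun p : ℝ => ((q.1, q.2.1, p) : J1)) q.2.2
      (hasFDerivAt_prolong h hq) hl))
  -- The slope is a fractional linear function of p, and the numerator of its derivative is the
  -- Jacobian, which is 1.
  have hx : ∀ p : ℝ, (prolong Φ (q.1, q.2.1, p)).2.2 =
      ((fderiv ℝ Φ (toJ0 q) (1, 0)).2 + p * (fderiv ℝ Φ (toJ0 q) (0, 1)).2) /
        ((fderiv ℝ Φ (toJ0 q) (1, 0)).1 + p * (fderiv ℝ Φ (toJ0 q) (0, 1)).1) := by
    intro p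
    simp only [prolong, prolongDen]
    rw [fderiv_J0_eq Φ _ 1 p]
    simp [toJ0]
  have hA : prolongDen Φ q =
      (fderiv ℝ Φ (toJ0 q) (1, 0)).1 + q.2.2 * (fderiv ℝ Φ (toJ0 q) (0, 1)).1 := by
    rw [prolongDen, fderiv_J0_eq Φ _ 1 q.2.2]
    simp
  have hA0 := h.prolongDen_ne_zero q hq
  have hJ := h.jacobian_eq_one _ (mem_image_of_mem toJ0 hq)
  rw [jacobian] at hJ
  rw [hA] at hA0 ⊢
  have h2 := (((hasDerivAt_id q.2.2).mul_const (fderiv ℝ Φ (toJ0 q) (0, 1)).2).const_add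
      (fderiv ℝ Φ (toJ0 q) (1, 0)).2).fun_div
    (((hasDerivAt_id q.2.2).mul_const (fderiv ℝ Φ (toJ0 q) (0, 1)).1).const_add
      (fderiv ℝ Φ (toJ0 q) (1, 0)).1) hA0
  have h3 := h1.unique (h2.congr_of_eventuallyEq (Filter.Eventually.of_forall hx))
  refine h3.trans ?_
  simp only [id]
  congr 1
  linarith

/-- The prolonged map carries the direction of the solutions to that of the other equation. -/
theorem fderiv_prolong_direction (h : IsAreaEquiv V f V' f' Φ) (hV : IsOpen V)
    (hf : AnalyticOnNhd ℝ f V) {q : J1} (hq : q ∈ V) :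
    (fderiv ℝ (prolong Φ) q (1, q.2.2, f q)).2.2 = f' (prolong Φ q) * prolongDen Φ q := by
  -- The hypothesis on Φ concerns whole solutions; a solution through q turns it into a pointwise
  -- statement at q.
  obtain ⟨I, y, hy, hqI, hyq⟩ := exists_solution_through hV hf hq
  obtain ⟨I', y', hy', him⟩ := h.maps_solutions I y hy
  have hcurve : ∀ x ∈ I, (Φ (x, y x)).1 ∈ I' ∧ y' (Φ (x, y x)).1 = (Φ (x, y x)).2 := by
    intro x hx
    have : Φ (x, y x) ∈ (fun t => (t, y' t)) '' I' := him ▸ mem_image_of_mem _ hx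
    obtain ⟨t, ht, e⟩ := this
    rw [← e]
    exact ⟨ht, rfl⟩
  have hd : ∀ x ∈ I, HasDerivAt (fun x => Φ (x, y x))
      (fderiv ℝ Φ (toJ0 (jet1 y x)) (1, deriv y x)) x := fun x hx =>
    HasFDerivAt.comp_hasDerivAt (f := fun x => (x, y x)) x
      (hasFDerivAt_pointMap h (hy.jet_mem x hx))
      ((hasDerivAt_id x).prodMk (hy.differentiableAt x hx).hasDerivAt)
  have hτ : ∀ x ∈ I, HasDerivAt (fun x => (Φ (x, y x)).1) (prolongDen Φ (jet1 y x)) x :=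
    fun x hx => hasDerivAt_fst_comp (hd x hx)
  -- Differentiating y'(χ) = φ along the solution shows that jets correspond under the prolongation.
  -- A second differentiation at q.1 then brings in f'.
  have hjet : ∀ x ∈ I, jet1 y' (Φ (x, y x)).1 = prolong Φ (jet1 y x) := by
    intro x hx
    have h1 := HasDerivAt.comp (h₂ := y') x
      (hy'.differentiableAt _ (hcurve x hx).1).hasDerivAt (hτ x hx)
    have h2 := (hasDerivAt_snd_comp (hd x hx)).congr_of_eventuallyEq
      (f₁ := y' ∘ fun x => (Φ (x, y x)).1)
      (Filter.eventually_of_mem (hy.isOpen.mem_nhds hx) fun x hx => (hcurve x hx).2)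
    have h3 := (eq_div_iff (h.prolongDen_ne_zero _ (hy.jet_mem x hx))).2 (h1.unique h2)
    rw [jet1, prolong, (hcurve x hx).2, h3]
    rfl
  have h1 := HasDerivAt.comp (h₂ := deriv y') q.1 (hy'.eqn _ (hcurve q.1 hqI).1) (hτ q.1 hqI)
  have hj : HasDerivAt (jet1 y) (1, deriv y q.1, f (jet1 y q.1)) q.1 :=
    (hasDerivAt_id q.1).prodMk ((hy.differentiableAt _ hqI).hasDerivAt.prodMk (hy.eqn _ hqI))
  have h2 := hasDerivAt_snd_comp (hasDerivAt_snd_comp (HasFDerivAt.comp_hasDerivAt q.1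
    (hasFDerivAt_prolong h (hy.jet_mem _ hqI)) hj))
  have h3 := h2.congr_of_eventuallyEq (f₁ := deriv y' ∘ fun x => (Φ (x, y x)).1)
    (Filter.eventually_of_mem (hy.isOpen.mem_nhds hqI) fun x hx =>
      congrArg (fun q : J1 => q.2.2) (hjet x hx))
  have h4 := h1.unique h3
  rw [hjet _ hqI, hyq] at h4
  have hp : deriv y q.1 = q.2.2 := congrArg (fun q : J1 => q.2.2) hyq
  rw [hp] at h4
  exact h4.symm

/-- The lift of the prolongation of `Φ` to the bundle. -/
def liftMap (Φ : J0 → J0) (b : Tot) : Tot :=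
  (prolong Φ b.1, prolongDen Φ b.1 * b.2.1,
    -(fderiv ℝ Φ (toJ0 b.1) (0, 1)).1 / b.2.1 + prolongDen Φ b.1 * b.2.2)

/-- The pull-backs of `dx`, `dy - p dx`, `dp - f dx + μ (dy - p dx)` by the prolonged map. -/
theorem prolong_pullback (h : IsAreaEquiv V f V' f' Φ) (hV : IsOpen V)
    (hf : AnalyticOnNhd ℝ f V) {q : J1} (hq : q ∈ V) (w : J1) :
    (fderiv ℝ (prolong Φ) q w).1 =
        prolongDen Φ q * w.1 + (fderiv ℝ Φ (toJ0 q) (0, 1)).1 * contact q w ∧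
      contact (prolong Φ q) (fderiv ℝ (prolong Φ) q w) = contact q w / prolongDen Φ q ∧
      ∀ μ' : J1 → ℝ, formPi f' μ' (prolong Φ q) (fderiv ℝ (prolong Φ) q w) =
        (w.2.2 - f q * w.1) / prolongDen Φ q ^ 2 +
          ((fderiv ℝ (prolong Φ) q (0, 1, 0)).2.2
            - f' (prolong Φ q) * (fderiv ℝ Φ (toJ0 q) (0, 1)).1
            + μ' (prolong Φ q) / prolongDen Φ q) * contact q w := by
  have hA : prolongDen Φ q =
      (fderiv ℝ Φ (toJ0 q) (1, 0)).1 + q.2.2 * (fderiv ℝ Φ (toJ0 q) (0, 1)).1 := by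
    rw [prolongDen, fderiv_J0_eq Φ _ 1 q.2.2]
    simp
  have hA0 := h.prolongDen_ne_zero q hq
  have hJ := h.jacobian_eq_one _ (mem_image_of_mem toJ0 hq)
  rw [jacobian] at hJ
  have hP : (prolong Φ q).2.2 * prolongDen Φ q =
      (fderiv ℝ Φ (toJ0 q) (1, 0)).2 + q.2.2 * (fderiv ℝ Φ (toJ0 q) (0, 1)).2 := by
    simp only [prolong]
    rw [div_mul_cancel₀ _ hA0, fderiv_J0_eq Φ _ 1 q.2.2]
    simp
  have hT := toJ0_fderiv_prolong h hq w
  rw [show toJ0 w = (w.1, w.2.1) from rfl, fderiv_J0_eq] at hT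
  have e1 : (fderiv ℝ (prolong Φ) q w).1 =
      prolongDen Φ q * w.1 + (fderiv ℝ Φ (toJ0 q) (0, 1)).1 * contact q w := by
    refine (congrArg Prod.fst hT).trans ?_
    rw [hA]
    simp
    ring
  have e2 : contact (prolong Φ q) (fderiv ℝ (prolong Φ) q w) = contact q w / prolongDen Φ q := by
    have e := congrArg Prod.snd hT
    change (fderiv ℝ (prolong Φ) q w).2.1 = _ at e
    rw [contact_apply, e, e1, eq_div_iff hA0]
    simp only [Prod.snd_add, Prod.smul_snd, smul_eq_mul, contact_apply]
    generalize (prolong Φ q).2.2 = P at *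
    generalize prolongDen Φ q = A at *
    generalize fderiv ℝ Φ (toJ0 q) (1, 0) = a at *
    generalize fderiv ℝ Φ (toJ0 q) (0, 1) = b at *
    -- After multiplication by A, inserting PA = φ_x + p φ_y and A = χ_x + p χ_y leaves the contact
    -- form times the Jacobian.
    linear_combination (w.2.1 - q.2.2 * w.1) * hJ
      + (-(A * w.1) - b.1 * (w.2.1 - q.2.2 * w.1)) * hP
      + b.2 * (w.2.1 - q.2.2 * w.1) * hA
  refine ⟨e1, e2, fun μ' => ?_⟩
  -- A frame adapted to the equation: the solution direction and ∂_p have known images, and the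
  -- ∂_y-term contributes only a multiple of the contact form, absorbed into μ.
  have hw : w = w.1 • ((1, q.2.2, f q) : J1) + contact q w • ((0, 1, 0) : J1)
      + (w.2.2 - f q * w.1) • ((0, 0, 1) : J1) := by
    ext <;> simp <;> ring
  have e3 : (fderiv ℝ (prolong Φ) q w).2.2 = w.1 * (f' (prolong Φ q) * prolongDen Φ q)
      + contact q w * (fderiv ℝ (prolong Φ) q (0, 1, 0)).2.2
      + (w.2.2 - f q * w.1) * (1 / prolongDen Φ q ^ 2) := by
    conv_lhs => rw [hw]
    rw [map_add, map_add, map_smul, map_smul, map_smul]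
    simp only [Prod.snd_add, Prod.smul_snd, smul_eq_mul]
    rw [fderiv_prolong_vertical h hq, fderiv_prolong_direction h hV hf hq]
  change (fderiv ℝ (prolong Φ) q w).2.2 - f' (prolong Φ q) * (fderiv ℝ (prolong Φ) q w).1
    + μ' (prolong Φ q) * contact (prolong Φ q) (fderiv ℝ (prolong Φ) q w) = _
  rw [e1, e2, e3]
  ring

theorem liftMap_analytic (h : IsAreaEquiv V f V' f' Φ) : AnalyticOnNhd ℝ (liftMap Φ) (bundle V) := by
  intro b hb
  have a1 : AnalyticAt ℝ (fun b : Tot => b.1) b := analyticAt_fst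
  have a2 : AnalyticAt ℝ (fun b : Tot => b.2.1) b := analyticAt_fst.fun_comp analyticAt_snd
  have a3 : AnalyticAt ℝ (fun b : Tot => b.2.2) b := analyticAt_snd.fun_comp analyticAt_snd
  have hD := (analyticAt_prolongDen h hb.1).fun_comp a1
  have hy := AnalyticAt.fun_comp (g := fun q : J1 => (fderiv ℝ Φ (toJ0 q) (0, 1)).1)
    (analyticAt_fst.fun_comp (analyticAt_fderiv_comp_toJ0 h hb.1 (0, 1))) a1
  exact ((analyticAt_prolong h hb.1).fun_comp a1).prod ((hD.fun_mul a2).prod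
    ((hy.fun_neg.fun_div a2 hb.2).fun_add (hD.fun_mul a3)))

theorem liftMap_equivariant (Φ : J0 → J0) {T : Matrix.SpecialLinearGroup (Fin 3) ℝ} (hT : T ∈ H)
    {b : Tot} (hb : b.2.1 ≠ 0) : liftMap Φ (act T b) = act T (liftMap Φ b) := by
  obtain ⟨v₁, v₃, hv, e⟩ := (mem_H_iff T).1 hT
  rw [e, act_hMat, act_hMat]
  ext
  · rfl
  · rfl
  · rfl
  · simp only [liftMap]
    ring
  · simp only [liftMap]
    field_simp
    ring

theorem liftMap_bijOn (h : IsAreaEquiv V f V' f' Φ) :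
    BijOn (liftMap Φ) (bundle V) (bundle V') := by
  refine ⟨fun b hb => ⟨h.bijOn.mapsTo hb.1, mul_ne_zero (h.prolongDen_ne_zero _ hb.1) hb.2⟩,
    ?_, ?_⟩
  · intro b hb c hc e
    have e1 : b.1 = c.1 := h.bijOn.injOn hb.1 hc.1 (congrArg Prod.fst e)
    have hA := h.prolongDen_ne_zero _ hc.1
    have e2 := congrArg (fun b : Tot => b.2.1) e
    have e3 := congrArg (fun b : Tot => b.2.2) e
    simp only [liftMap, e1] at e2 e3
    have e2' := mul_left_cancel₀ hA e2
    rw [e2'] at e3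
    have e3' := mul_left_cancel₀ hA (add_left_cancel e3)
    exact Prod.ext e1 (Prod.ext e2' e3')
  · rintro c ⟨hc, hc'⟩
    obtain ⟨q, hq, e⟩ := h.bijOn.surjOn hc
    have hA := h.prolongDen_ne_zero _ hq
    have hc' : c.2.1 ≠ 0 := hc'
    refine ⟨(q, c.2.1 / prolongDen Φ q, (c.2.2
      + (fderiv ℝ Φ (toJ0 q) (0, 1)).1 / (c.2.1 / prolongDen Φ q)) / prolongDen Φ q),
      ⟨hq, div_ne_zero hc' hA⟩, ?_⟩
    refine Prod.ext e (Prod.ext ?_ ?_)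
    · simp only [liftMap]
      field_simp
    · simp only [liftMap]
      field_simp
      ring

/-- An equivariant map relates the fundamental vector fields. -/
theorem fderiv_fundVec {F : Tot → Tot} {b : Tot} (hd : DifferentiableAt ℝ F b)
    (he : ∀ T ∈ H, F (act T b) = act T (F b)) {X : Mat3} (hX : X ∈ hLie) :
    fderiv ℝ F b (fundVec X b) = fundVec X (F b) := by
  have h8 : X 2 2 = -X 1 1 := by linarith [hX.1.2.2.2]
  have h0 : HasDerivAt (fun t : ℝ => 1 + t * X 1 1) (X 1 1) 0 := by
    simpa using ((hasDerivAt_id (0 : ℝ)).mul_const (X 1 1)).const_add 1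
  -- This curve has the same velocity at 0 as b · exp(tX), and its matrix visibly lies in H for
  -- small t, so equivariance applies to it.
  have hc : ∀ b : Tot, HasDerivAt (fun t : ℝ => act (hMat (1 + t * X 1 1) (t * -X 1 2)) b)
      (fundVec X b) 0 := by
    intro b
    simp only [act_hMat]
    refine ((hasDerivAt_const (0 : ℝ) b.1).prodMk ((h0.const_mul b.2.1).prodMk
      ((((hasDerivAt_const (0 : ℝ) b.2.2).fun_div h0 (by simp)).fun_add
        (((hasDerivAt_id (0 : ℝ)).mul_const (-X 1 2)).const_mul b.2.1))))).congr_deriv ?_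
    rw [fundVec_eq, h8]
    ext <;> simp
    ring
  have hb0 : act (hMat (1 + (0 : ℝ) * X 1 1) ((0 : ℝ) * -X 1 2)) b = b := by
    rw [act_hMat]
    simp
  have h1 := HasFDerivAt.comp_hasDerivAt (l := F)
    (f := fun t : ℝ => act (hMat (1 + t * X 1 1) (t * -X 1 2)) b) (l' := fderiv ℝ F b) 0
    (by rw [hb0]; exact hd.hasFDerivAt) (hc b)
  refine h1.unique ((hc (F b)).congr_of_eventuallyEq ?_)
  have hne : 1 + (0 : ℝ) * X 1 1 ≠ 0 := by simp
  filter_upwards [h0.continuousAt.eventually_ne hne] with t ht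
  exact he _ (hElt_mem _ _ ht)

/-- The pull-back of the connection of the second equation by the lift. -/
theorem liftMap_pullback (h : IsAreaEquiv V f V' f' Φ) (hf : IsSpecialODE V f)
    (hf' : IsSpecialODE V' f') {b : Tot} (hb : b ∈ bundle V) (v : Tot) :
    matEval (cartanForm f') (liftMap Φ b) (fderiv ℝ (liftMap Φ) b v) =
      matEval (cartanForm f) b v := by
  have hV := hf.isOpen
  have hm : ∀ b ∈ bundle V, liftMap Φ b ∈ bundle V' := (liftMap_bijOn h).mapsTo
  have han := liftMap_analytic h
  have hsm : ∀ b ∈ bundle V, ContDiffAt ℝ (⊤ : ℕ∞) (liftMap Φ) b := fun b hb =>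
    (han b hb).contDiffAt
  have hfd : ∀ b ∈ bundle V, HasFDerivAt (liftMap Φ) (fderiv ℝ (liftMap Φ) b) b := fun b hb =>
    (han b hb).differentiableAt.hasFDerivAt
  have hact : ∀ T ∈ H, ∀ b ∈ bundle V, ∀ v,
      fderiv ℝ (liftMap Φ) (act T b) (act T v) = act T (fderiv ℝ (liftMap Φ) b v) := by
    intro T hT b hb v
    have h1 := (hfd _ (act_mem_bundle hT hb)).comp b (hasFDerivAt_act T b)
    have h2 := (hasFDerivAt_act T (liftMap Φ b)).comp b (hfd b hb)
    have h3 := h2.congr_of_eventuallyEq (f₁ := liftMap Φ ∘ act T)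
      (Filter.eventually_of_mem ((isOpen_bundle hV).mem_nhds hb) fun b hb =>
        liftMap_equivariant Φ hT hb.2)
    exact congrArg (· v) (h1.unique h3)
  -- The pulled-back connection; once its normality for f is shown, `normal_unique` identifies it.
  let ω : Matrix (Fin 3) (Fin 3) (Tot → Tot →L[ℝ] ℝ) :=
    Matrix.of fun i j => pullForm (liftMap Φ) (cartanForm f' i j)
  have hω : ∀ b v, matEval ω b v =
      matEval (cartanForm f') (liftMap Φ b) (fderiv ℝ (liftMap Φ) b v) := fun _ _ => rfl
  have hbase : ∀ q ∈ V, ∀ w, (fderiv ℝ (liftMap Φ) (unitSection q) (w, 0)).1 =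
      fderiv ℝ (prolong Φ) q w := by
    intro q hq w
    have h1 : HasFDerivAt (fun q => (liftMap Φ (unitSection q)).1) _ q :=
      ((hfd _ (unitSection_mem hq)).comp q (hasFDerivAt_unitSection q)).fst
    exact congrArg (· w) (h1.unique (hasFDerivAt_prolong h hq))
  have hd : ∀ i j, ∀ b ∈ bundle V, DifferentiableAt ℝ (ω i j) b := by
    intro i j b hb
    have h1 := (cartanForm_differentiableAt hf'.analytic (hm b hb) i j).comp b
      (hfd b hb).differentiableAt
    have h2 := (han.fderiv b hb).differentiableAt
    exact h1.clm_comp h2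
  have t1 : ∀ q ∈ V, ∀ w, theta1 (liftMap Φ (unitSection q))
      (fderiv ℝ (liftMap Φ) (unitSection q) (w, 0)) = contact q w := by
    intro q hq w
    have hA := h.prolongDen_ne_zero q hq
    rw [theta1_apply, hbase q hq]
    refine (congrArg _ (prolong_pullback h hV hf.analytic hq w).2.1).trans ?_
    simp only [liftMap, unitSection]
    field_simp
  have t3 : ∀ q ∈ V, ∀ w, theta3 (liftMap Φ (unitSection q))
      (fderiv ℝ (liftMap Φ) (unitSection q) (w, 0)) = formX q w := by
    intro q hq w
    have hA := h.prolongDen_ne_zero q hq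
    obtain ⟨e1, e2, -⟩ := prolong_pullback h hV hf.analytic hq w
    rw [theta3_apply, hbase q hq]
    change _ * contact (prolong Φ q) _ + _ = _
    rw [e1, e2]
    simp only [liftMap, unitSection, formX_apply]
    field_simp
    ring
  -- Curvature commutes with pull-back, so the vanishing entries for f' give the vanishing entries
  -- required of ω.
  have hc : ∀ q ∈ V, ∀ i j v w, curvature (sectionPull ω) i j q v w =
      curvatureRHS f' (liftMap Φ (unitSection q)) (fderiv ℝ (liftMap Φ) (unitSection q) (v, 0))
        (fderiv ℝ (liftMap Φ) (unitSection q) (w, 0)) i j := by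
    intro q hq i j v w
    have hb := unitSection_mem hq
    rw [curvature_sectionPull fun i j => hd i j _ hb, curvature_pullForm
      ((han _ hb).contDiffAt) (cartanForm_differentiableAt hf'.analytic (hm _ hb)),
      curvature_cartanForm hf' (hm _ hb)]
  rw [← hω]
  refine normal_unique hV hf.analytic hd (fun b hb v => cartanForm_mem_asl _ _ _) ?_ ?_ ?_ hb v
  · intro T hT b hb v
    rw [hω, hω, fderiv_act, hact T hT b hb, liftMap_equivariant Φ hT hb.2,
      ← cartanForm_equivariant f' hT (hm b hb).2, fderiv_act]
  · intro b hb X hX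
    rw [hω, fderiv_fundVec (hfd b hb).differentiableAt
      (fun T hT => liftMap_equivariant Φ hT hb.2) hX]
    exact (isCartanConnection hf'.analytic).fundamental _ (hm b hb) X hX
  · constructor
    · exact fun q hq => ContinuousLinearMap.ext fun w => t3 q hq w
    · exact fun q hq => ContinuousLinearMap.ext fun w => t1 q hq w
    -- The contact coefficient in `prolong_pullback`, multiplied by the factor u₁² of θ². Its value
    -- is immaterial: normality asks only for some μ.
    · refine ⟨fun q => prolongDen Φ q ^ 2 * ((fderiv ℝ (prolong Φ) q (0, 1, 0)).2.2
        - f' (prolong Φ q) * (fderiv ℝ Φ (toJ0 q) (0, 1)).1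
        + (-(1 / 3) * dP f' (prolong Φ q)) / prolongDen Φ q), fun q hq =>
        ContinuousLinearMap.ext fun w => ?_⟩
      have hA := h.prolongDen_ne_zero q hq
      change theta2 f' (liftMap Φ (unitSection q))
        (fderiv ℝ (liftMap Φ) (unitSection q) (w, 0)) = _
      rw [theta2_apply, hbase q hq]
      refine (congrArg _ ((prolong_pullback h hV hf.analytic hq w).2.2
        fun q => -(1 / 3) * dP f' q)).trans ?_
      simp only [liftMap, unitSection, formPi_apply, contact_apply]
      field_simp
    · intro q hq v w
      rw [hc q hq]
      simp [curvatureRHS]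
    · intro q hq v w
      rw [hc q hq]
      simp [curvatureRHS]
    · refine ⟨fun q => inv1 f' (liftMap Φ (unitSection q)), fun q hq v w => ?_⟩
      rw [hc q hq]
      simp only [curvatureRHS, wedge, t1 q hq, t3 q hq]
      simp
    · refine ⟨fun q => 0, fun q hq v w => ?_⟩
      rw [hc q hq]
      simp [curvatureRHS]

theorem isCartanIso_liftMap (h : IsAreaEquiv V f V' f' Φ) (hf : IsSpecialODE V f)
    (hf' : IsSpecialODE V' f') : IsCartanIso V f V' f' (liftMap Φ) where
  analytic := liftMap_analytic h
  bijOn := liftMap_bijOn h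
  equivariant := fun _ hT _ hb => liftMap_equivariant Φ hT hb.2
  pullback := fun _ hb v => liftMap_pullback h hf hf' hb v

end Equiv

theorem isSpecialODE_mono {U V : Set J1} {f : J1 → ℝ} (h : IsSpecialODE U f) (hV : IsOpen V)
    (hVU : V ⊆ U) : IsSpecialODE V f :=
  ⟨hV, fun q hq => h.analytic q (hVU hq), fun q hq => h.relInv_eq_zero q (hVU hq)⟩

/-! ### Invariance of the curvature functions -/

/-- F matches both the curvatures and the θ's, so the coefficients of the curvature with respect to
the θ's agree. -/
theorem invariants_eq {U U' : Set J1} {f f' : J1 → ℝ} (hf : IsSpecialODE U f)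
    (hf' : IsSpecialODE U' f') {F : Tot → Tot} (hF : IsCartanIso U f U' f' F) {b : Tot}
    (hb : b ∈ bundle U) :
    inv1 f' (F b) = inv1 f b ∧ inv2 f' (F b) = inv2 f b ∧ inv3 f' (F b) = inv3 f b := by
  have hFb := hF.bijOn.mapsTo hb
  have hp : ∀ i j, ∀ b ∈ bundle U, cartanForm f i j b =
      (Matrix.of fun i j => pullForm F (cartanForm f' i j)) i j b := fun i j b hb =>
    ContinuousLinearMap.ext fun v => (congrFun (congrFun (hF.pullback b hb v) i) j).symm
  have hc : ∀ i j v w, curvatureRHS f b v w i j =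
      curvatureRHS f' (F b) (fderiv ℝ F b v) (fderiv ℝ F b w) i j := by
    intro i j v w
    rw [← curvature_cartanForm hf hb, ← curvature_cartanForm hf' hFb,
      ← curvature_pullForm (hF.analytic b hb).contDiffAt
        (cartanForm_differentiableAt hf'.analytic hFb)]
    exact curvature_congr (fun i j => Filter.eventually_of_mem
      ((isOpen_bundle hf.isOpen).mem_nhds hb) (hp i j)) i j v w
  have t1 : ∀ v, theta1 (F b) (fderiv ℝ F b v) = theta1 b v := fun v =>
    congrFun (congrFun (hF.pullback b hb v) 2) 0
  have t2 : ∀ v, theta2 f' (F b) (fderiv ℝ F b v) = theta2 f b v := fun v =>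
    congrFun (congrFun (hF.pullback b hb v) 2) 1
  have t3 : ∀ v, theta3 (F b) (fderiv ℝ F b v) = theta3 b v := fun v =>
    congrFun (congrFun (hF.pullback b hb v) 1) 0
  have c11 := fun v w => hc 1 1 v w
  have c12 := fun v w => hc 1 2 v w
  simp only [curvatureRHS, wedge, t1, t2, t3] at c11 c12
  have hne := hb.2
  -- Vectors dual to the coframe isolate single coefficients: θ³ ∧ θ¹ in Θ¹₁ gives I₁; θ³ ∧ θ¹ and
  -- θ² ∧ θ¹ in Θ¹₂ give I₃ and I₂.
  have a := c11 (coframeInv f b 0 0 1 0 0) (coframeInv f b 1 0 0 0 0)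
  have a' := c12 (coframeInv f b 0 0 1 0 0) (coframeInv f b 1 0 0 0 0)
  have a'' := c12 (coframeInv f b 0 1 0 0 0) (coframeInv f b 1 0 0 0 0)
  simp [theta1_coframeInv _ _ _ _ _ _ hne, theta2_coframeInv _ _ _ _ _ _ hne,
    theta3_coframeInv _ _ _ _ _ _ hne] at a a' a''
  exact ⟨a.symm, a''.symm, a'.symm⟩

end AreaPreservingODE

end

/-! ### The main theorem -/

open AreaPreservingODE in
theorem theorem4p6 :
    -- the Cartan geometry, its normality and uniqueness, its curvature
    (∀ (U : Set J1) (f : J1 → ℝ), IsSpecialODE U f →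
      IsPrincipalHBundle (bundle U) U Prod.fst act ∧
      IsCartanConnection U (cartanForm f) ∧
      IsNormal U f (cartanForm f) ∧
      (∀ ω : Matrix (Fin 3) (Fin 3) (Tot → Tot →L[ℝ] ℝ),
        IsCartanConnection U ω → IsNormal U f ω →
          ∀ i j, ∀ b ∈ bundle U, ω i j b = cartanForm f i j b) ∧
      (∀ b ∈ bundle U, ∀ v w i j,
        curvature (cartanForm f) i j b v w = curvatureRHS f b v w i j) ∧
      StructureEquations U f) ∧
    -- the equivalence problem
    (∀ (U U' : Set J1) (f f' : J1 → ℝ), IsSpecialODE U f → IsSpecialODE U' f' →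
      -- equivalence of the whole equations
      ((∀ x y : ℝ, IsPreconnected {p : ℝ | (x, y, p) ∈ U}) →
        ((∃ Φ, IsAreaEquiv U f U' f' Φ) ↔ ∃ F, IsCartanIso U f U' f' F)) ∧
      -- local equivalence at a pair of points
      (∀ q ∈ U, ∀ q' ∈ U',
        ((∃ (V V' : Set J1) (Φ : J0 → J0), IsOpen V ∧ q ∈ V ∧ V ⊆ U ∧
            IsOpen V' ∧ q' ∈ V' ∧ V' ⊆ U' ∧ IsAreaEquiv V f V' f' Φ ∧ prolong Φ q = q') ↔
          ∃ (V V' : Set J1) (F : Tot → Tot), IsOpen V ∧ q ∈ V ∧ V ⊆ U ∧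
            IsOpen V' ∧ q' ∈ V' ∧ V' ⊆ U' ∧ IsCartanIso V f V' f' F ∧
            ∀ b ∈ bundle V, b.1 = q → (F b).1 = q')) ∧
      -- the functions in the curvature are invariants
      (∀ F, IsCartanIso U f U' f' F → ∀ b ∈ bundle U,
        inv1 f' (F b) = inv1 f b ∧ inv2 f' (F b) = inv2 f b ∧ inv3 f' (F b) = inv3 f b)) := by
  refine ⟨fun U f h => ⟨isPrincipalHBundle h.isOpen, isCartanConnection h.analytic,
    isNormal_cartanForm h, ?_, fun b hb v w i j => curvature_cartanForm h hb v w i j,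
    structureEquations h⟩, fun U U' f f' h h' => ⟨fun hconn => ⟨?_, ?_⟩,
    fun q hq q' hq' => ⟨?_, ?_⟩, fun F hF b hb => invariants_eq h h' hF hb⟩⟩
  · intro ω hω hn i j b hb
    refine ContinuousLinearMap.ext fun v => congrFun (congrFun (normal_unique h.isOpen h.analytic
      (fun i j b hb => ?_) (fun b hb v => (hω.iso b hb).mapsTo (mem_univ v)) hω.equivariant
      hω.fundamental hn hb v) i) j
    exact ((hω.smooth i j).contDiffAt ((isOpen_bundle h.isOpen).mem_nhds hb)).differentiableAt
      (by simp)
  · rintro ⟨Φ, hΦ⟩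
    exact ⟨liftMap Φ, isCartanIso_liftMap hΦ h h'⟩
  · rintro ⟨F, hF⟩
    obtain ⟨Φ, hΦ, -⟩ := isAreaEquiv_of_isCartanIso hF h.isOpen hconn
    exact ⟨Φ, hΦ⟩
  · rintro ⟨V, V', Φ, hV, hqV, hVU, hV', hqV', hVU', hΦ, e⟩
    refine ⟨V, V', liftMap Φ, hV, hqV, hVU, hV', hqV', hVU', isCartanIso_liftMap hΦ
      (isSpecialODE_mono h hV hVU) (isSpecialODE_mono h' hV' hVU'), fun b _ hbq => ?_⟩
    rw [← e, ← hbq]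
    rfl
  · rintro ⟨V, V', F, hV, hqV, hVU, hV', hqV', hVU', hF, e⟩
    -- The fibres of V need not be connected. On a ball they are, and V' is replaced by the image of
    -- the ball.
    obtain ⟨ε, hε, hball⟩ := Metric.isOpen_iff.1 hV q hqV
    have hF' := isCartanIso_restrict hF hball
    obtain ⟨Φ, hΦ, hΦF⟩ := isAreaEquiv_of_isCartanIso hF' Metric.isOpen_ball
      (isPreconnected_fibre_ball q ε)
    have hqB : q ∈ Metric.ball q ε := Metric.mem_ball_self hε
    have hq0 : baseMap F q = q' := e _ (unitSection_mem hqV) rfl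
    refine ⟨Metric.ball q ε, baseMap F '' Metric.ball q ε, Φ, Metric.isOpen_ball, hqB,
      hball.trans hVU, isOpen_image_baseMap hF hball Metric.isOpen_ball, ⟨q, hqB, hq0⟩, ?_, hΦ,
      (hΦF q hqB).trans hq0⟩
    rintro _ ⟨q₁, hq₁, rfl⟩
    exact hVU' ((baseMap_bijOn hF).mapsTo (hball hq₁))
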